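/- All graphs are finite, undirected and loop-free, and every node carries a set of labels from a fixed finite set $P$ of binary node features. A pointed graph is a pair $(G,v)$ of a graph and one of its nodes; a rooted graph is a pointed graph $(F,u)$ in which every node is reachable from $u$. A homomorphism from $(F,u)$ to $(G,v)$ is a map $h:V_F\to V_G$ that maps edges to edges, satisfies $\mathrm{lab}_F(w)\subseteq \mathrm{lab}_G(h(w))$ for all $w$, and $h(u)=v$. For $\mathfrak F=\{(F_1,u_1),\dots,(F_k,u_k)\}$ let $\hom(\mathfrak F,(G,v))\in\mathbb R^k$ be the vector whose $i$-th entry is the number of homomorphisms from $(F_i,u_i)$ to $(G,v)$. *Ego-rank.* For a rooted graph $(F,u)$ with node set $V$ and $dep:V\to V\cup\{\bot\}$ put $deps(a)=\{dep(a),dep(dep(a)),\dots\}\setminus\{\bot\}$. Call $dep$ admissible if (i) $dep(u)=\bot$; (ii) for each edge $(a,b)$, $dep(a)=dep(b)$ or $a\in deps(b)$ or $b\in deps(a)$; (iii) every set $dep^{-1}(c)$, $c\in V\cup\{\bot\}$, induces an acyclic subgraph. The ego-rank of $(F,u)$ is the minimum of $\max_{a\in V}|deps(a)|$ over admissible $dep$.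 *GNNs.* A $(D,D')$-GNN consists of $L\ge1$ layers $(\mathrm{com}_i,\mathrm{agg}_i)$ with $\mathrm{agg}_i$ a function from finite multisets over $\mathbb R^{D_i}$ to $\mathbb R^{D_i}$ and $\mathrm{com}_i:\mathbb R^{2D_i}\to\mathbb R^{D_{i+1}}$, where $D_1=D$, $D_{L+1}=D'$ and $D_i\ge 1$ for $1<i\le L$. On a graph $G=(V,E,\mathrm{lab})$ with an embedding $\mathrm{emb}^0:V\to\mathbb R^D$ it returns $\mathrm{emb}^L$, where $\mathrm{emb}^i(v)=\mathrm{com}_i\big(\mathrm{emb}^{i-1}(v)\oplus \mathrm{agg}_i(\{\!\{\mathrm{emb}^{i-1}(w): (v,w)\in E\}\!\})\big)$ and $\oplus$ is concatenation. *HE-GNNs.* A $(D,D')$-HE-GNN of nesting depth $0$ is a $(D,D')$-GNN. One of nesting depth $d>0$ is a pair $(\mathcal B,\mathcal C)$ of a $(D+1,D'')$-HE-GNN $\mathcal B$ of nesting depth $d-1$ and a $(D+D'',D')$-GNN $\mathcal C$; on $(G,\mathrm{emb})$ it returns the result of $\mathcal C$ on $(G,\mathrm{emb}')$, where $\mathrm{emb}'(v)=\mathrm{emb}(v)\oplus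 \mathrm{run}_{\mathcal B}(G,\{w\mapsto \mathrm{emb}(w)\oplus\delta_{wv}\})(v)$. Write $\mathrm{emb}_G(v)\in\{0,1\}^{|P|}$ for the multi-hot encoding of $\mathrm{lab}(v)$, and $\mathrm{run}_{\mathcal A}(G)=\mathrm{run}_{\mathcal A}(G,\mathrm{emb}_G)$. **Theorem.** Let $\mathfrak F$ be a finite set of rooted graphs, each of ego-rank at most $d$. 1. There is a $(|P|,|P|+|\mathfrak F|)$-HE-GNN $\mathcal A$ of nesting depth $d$, all of whose combination functions are feed-forward networks that use ReLU and multiplication (each layer is an affine map followed by ReLU, or a coordinatewise product of two affine maps; the output layer is affine), and whose aggregation functions are not restricted, such that $\mathrm{run}_{\mathcal A}(G)(v)=\mathrm{emb}_G(v)\oplus\hom(\mathfrak F,(G,v))$ for all pointed graphs $(G,v)$. 2. For each $N>0$ there is a $(|P|,|P|+|\mathfrak F|)$-HE-GNN $\mathcal A$ of nesting depth $d$, all of whose aggregation functions are the pointwise sum and all of whose combination functions are feed-forward networks with ReLU activation and affine output layer, such that $\mathrm{run}_{\mathcal A}(G)(v)=\mathrm{emb}_G(v)\oplus\hom(\mathfrak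 F,(G,v))$ for all pointed graphs $(G,v)$ of degree at most $N$. -/

import Mathlib

/-! ### Graphs, rooted graphs, homomorphism counts -/

universe u v

/-- A finite graph (symmetric irreflexive edge relation) whose nodes carry a set of labels out of
`p` binary node features. -/
structure LGraph (p : ℕ) : Type (u + 1) where
  V : Type u
  [fintypeV : Fintype V]
  graph : SimpleGraph V
  lab : V → Finset (Fin p)

attribute [instance] LGraph.fintypeV

/-- A rooted graph: a pointed graph in which every node is reachable from the root. -/
structure RootedGraph (p : ℕ) : Type (u + 1) extends LGraph.{u} p where
  root : V
  reachable : ∀ w, graph.Reachable root w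

/-- `h` is a homomorphism from the pointed graph `(F, F.root)` to the pointed graph `(G, x)`. -/
structure IsPointedHom {p : ℕ} (F : RootedGraph.{u} p) (G : LGraph.{v} p) (x : G.V)
    (h : F.V → G.V) : Prop where
  map_adj : ∀ a b, F.graph.Adj a b → G.graph.Adj (h a) (h b)
  map_lab : ∀ a, F.lab a ⊆ G.lab (h a)
  map_root : h F.root = x

/-- The number of homomorphisms from `(F, F.root)` to `(G, x)`. -/
noncomputable def homCount {p : ℕ} (F : RootedGraph.{u} p) (G : LGraph.{v} p) (x : G.V) : ℕ :=
  Nat.card {h : F.V → G.V // IsPointedHom F G x h}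

/-! ### Ego-rank -/

/-- `deps dep a` is `{dep a, dep (dep a), …}` without `⊥` (which is `none` here). -/
def deps {V : Type u} (dep : V → Option V) (a : V) : Set V :=
  {b | Relation.TransGen (fun x y => dep x = some y) a b}

/-- The three requirements on a dependency function `dep : V → V ∪ {⊥}`. -/
structure IsDepFunction {p : ℕ} (F : RootedGraph.{u} p) (dep : F.V → Option F.V) : Prop where
  root : dep F.root = none
  edge : ∀ a b, F.graph.Adj a b → dep a = dep b ∨ a ∈ deps dep b ∨ b ∈ deps dep a
  acyclic : ∀ c : Option F.V, (F.graph.induce {a | dep a = c}).IsAcyclic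

/-- The maximal node rank `max_a |deps a|` of a dependency function. -/
noncomputable def maxNodeRank {p : ℕ} (F : RootedGraph.{u} p) (dep : F.V → Option F.V) : ℕ :=
  Finset.univ.sup fun a => (deps dep a).ncard

/-- The ego-rank: the least maximal node rank over all dependency functions. -/
noncomputable def egoRank {p : ℕ} (F : RootedGraph.{u} p) : ℕ :=
  sInf {r | ∃ dep, IsDepFunction F dep ∧ maxNodeRank F dep = r}

/-- Dependency functions exist, so that the infimum in `egoRank` is attained. -/
theorem exists_isDepFunction {p : ℕ} (F : RootedGraph.{u} p) : ∃ dep, IsDepFunction F dep := by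
  classical
  obtain ⟨n, ⟨e₀⟩⟩ : ∃ n : ℕ, Nonempty (F.V ≃ Fin (n + 1)) := by
    refine ⟨Fintype.card F.V - 1, ⟨?_⟩⟩
    have : 0 < Fintype.card F.V := Fintype.card_pos_iff.mpr ⟨F.root⟩
    exact (Fintype.equivFin F.V).trans (finCongr (by omega))
  let e : F.V ≃ Fin (n + 1) := e₀.trans (Equiv.swap (e₀ F.root) 0)
  have he : e F.root = 0 := by simp [e]
  let dep : F.V → Option F.V := fun a =>
    if e a = 0 then none else some (e.symm ⟨(e a).val - 1, by omega⟩)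
  have key : ∀ m : ℕ, ∀ a b : F.V, (e b).val = m → (e a).val < m → a ∈ deps dep b := by
    intro m
    induction m with
    | zero => intro a b _ h; omega
    | succ m ih =>
      intro a b hb hab
      have hb0 : e b ≠ 0 := by
        intro h; rw [h] at hb; simp at hb
      have hstep : dep b = some (e.symm ⟨(e b).val - 1, by omega⟩) := by simp [dep, hb0]
      by_cases ham : (e a).val = m
      · apply Relation.TransGen.single
        rw [hstep]
        congr 1
        rw [Equiv.symm_apply_eq]
        ext; simp; omega
      · exact Relation.TransGen.head hstep (ih a _ (by simp; omega) (by omega))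
  refine ⟨dep, ⟨by simp [dep, he], ?_, ?_⟩⟩
  · intro a b hab
    have hne : (e a).val ≠ (e b).val := by
      intro h
      exact hab.ne (e.injective (Fin.ext h))
    rcases Nat.lt_or_gt_of_ne hne with h | h
    · exact Or.inr (Or.inl (key _ a b rfl h))
    · exact Or.inr (Or.inr (key _ b a rfl h))
  · intro c
    have hinj : ∀ a b : F.V, dep a = dep b → a = b := by
      intro a b h
      apply e.injective
      by_cases ha : e a = 0 <;> by_cases hb : e b = 0
      · rw [ha, hb]
      · simp [dep, ha, hb] at h
      · simp [dep, ha, hb] at h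
      · simp [dep, ha, hb] at h
        have ha' : (e a).val ≠ 0 := fun h' => ha (Fin.ext h')
        have hb' : (e b).val ≠ 0 := fun h' => hb (Fin.ext h')
        ext; omega
    have : Subsingleton {a | dep a = c} :=
      ⟨fun a b => Subtype.ext (hinj _ _ (a.2.trans b.2.symm))⟩
    intro x w hw
    exact (w.adj_snd hw.not_nil).ne (Subsingleton.elim _ _)

/-! ### Graph neural networks -/

/-- One layer: an aggregation function on finite multisets and a combination function. -/
structure GNNLayer (D D' : ℕ) where
  agg : Multiset (Fin D → ℝ) → (Fin D → ℝ)
  com : (Fin (D + D) → ℝ) → (Fin D' → ℝ)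

open Classical in
/-- `emb'(x) = com (emb(x) ⊕ agg {{emb(y) | (x,y) ∈ E}})`. -/
noncomputable def GNNLayer.run {p D D' : ℕ} (L : GNNLayer D D') (G : LGraph.{v} p)
    (emb : G.V → Fin D → ℝ) (x : G.V) : Fin D' → ℝ :=
  L.com (Fin.append (emb x)
    (L.agg ((Finset.univ.filter fun y => G.graph.Adj x y).val.map emb)))

/-- A `(D, D')`-GNN: a nonempty sequence of layers, all intermediate dimensions being positive. -/
inductive GNN : ℕ → ℕ → Type
  | last {D D' : ℕ} (L : GNNLayer D D') : GNN D D'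
  | cons {D E D' : ℕ} (hE : 1 ≤ E) (L : GNNLayer D E) (A : GNN E D') : GNN D D'

noncomputable def GNN.run {p : ℕ} (G : LGraph.{v} p) :
    {D D' : ℕ} → GNN D D' → (G.V → Fin D → ℝ) → (G.V → Fin D' → ℝ)
  | _, _, .last L, emb => L.run G emb
  | _, _, .cons _ L A, emb => A.run G (L.run G emb)

/-- All layers of the GNN satisfy `Q`. -/
def GNN.AllLayers (Q : ∀ {D D' : ℕ}, GNNLayer D D' → Prop) : {D D' : ℕ} → GNN D D' → Prop
  | _, _, .last L => Q L
  | _, _, .cons _ L A => Q L ∧ A.AllLayers Q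

/-! ### Hierarchical ego GNNs -/

/-- `HEGNN d D D'`: the `(D, D')`-HE-GNNs of nesting depth `d`. -/
inductive HEGNN : ℕ → ℕ → ℕ → Type
  | base {D D' : ℕ} (C : GNN D D') : HEGNN 0 D D'
  | ego {d D D'' D' : ℕ} (B : HEGNN d (D + 1) D'') (C : GNN (D + D'') D') : HEGNN (d + 1) D D'

open Classical in
/-- Extend every node embedding by one coordinate that marks the node `x`. -/
noncomputable def markNode {p D : ℕ} (G : LGraph.{v} p) (emb : G.V → Fin D → ℝ) (x : G.V) :
    G.V → Fin (D + 1) → ℝ :=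
  fun y => Fin.append (emb y) (fun _ : Fin 1 => if y = x then 1 else 0)

noncomputable def HEGNN.run {p : ℕ} (G : LGraph.{v} p) :
    {d D D' : ℕ} → HEGNN d D D' → (G.V → Fin D → ℝ) → (G.V → Fin D' → ℝ)
  | _, _, _, .base C, emb => C.run G emb
  | _, _, _, .ego B C, emb =>
      C.run G fun x => Fin.append (emb x) (B.run G (markNode G emb x) x)

/-- All layers of all GNNs of which the HE-GNN is built satisfy `Q`. -/
def HEGNN.AllLayers (Q : ∀ {D D' : ℕ}, GNNLayer D D' → Prop) :
    {d D D' : ℕ} → HEGNN d D D' → Prop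
  | _, _, _, .base C => C.AllLayers Q
  | _, _, _, .ego B C => B.AllLayers Q ∧ C.AllLayers Q

/-- The multi-hot label encoding `emb_G`. -/
def labelEmb {p : ℕ} (G : LGraph.{v} p) : G.V → Fin p → ℝ :=
  fun x i => if i ∈ G.lab x then 1 else 0

/-! ### Feed-forward networks -/

/-- The functions `ℝⁿ → ℝᵐ` computed by fully connected feed-forward networks with ReLU activation
in the hidden layers and an affine output layer. -/
inductive IsReLUFFNN : {n m : ℕ} → ((Fin n → ℝ) → (Fin m → ℝ)) → Prop
  | output {n m : ℕ} (W : Matrix (Fin m) (Fin n) ℝ) (b : Fin m → ℝ) :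
      IsReLUFFNN fun x => W.mulVec x + b
  | relu {n k m : ℕ} (W : Matrix (Fin k) (Fin n) ℝ) (b : Fin k → ℝ)
      {g : (Fin k → ℝ) → (Fin m → ℝ)} (hg : IsReLUFFNN g) :
      IsReLUFFNN fun x => g fun i => max 0 ((W.mulVec x + b) i)

/-- As above, where hidden layers may moreover be multiplication layers, in which every unit outputs
the product of two affine functions of its inputs. -/
inductive IsReLUMulFFNN : {n m : ℕ} → ((Fin n → ℝ) → (Fin m → ℝ)) → Prop
  | output {n m : ℕ} (W : Matrix (Fin m) (Fin n) ℝ) (b : Fin m → ℝ) :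
      IsReLUMulFFNN fun x => W.mulVec x + b
  | relu {n k m : ℕ} (W : Matrix (Fin k) (Fin n) ℝ) (b : Fin k → ℝ)
      {g : (Fin k → ℝ) → (Fin m → ℝ)} (hg : IsReLUMulFFNN g) :
      IsReLUMulFFNN fun x => g fun i => max 0 ((W.mulVec x + b) i)
  | mul {n k m : ℕ} (W W' : Matrix (Fin k) (Fin n) ℝ) (b b' : Fin k → ℝ)
      {g : (Fin k → ℝ) → (Fin m → ℝ)} (hg : IsReLUMulFFNN g) :
      IsReLUMulFFNN fun x => g fun i => (W.mulVec x + b) i * (W'.mulVec x + b') i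

/-- The combination function is a feed-forward network with ReLU and multiplication. -/
def GNNLayer.UsesReLUMul {D D' : ℕ} (L : GNNLayer D D') : Prop :=
  IsReLUMulFFNN L.com

/-- The aggregation is the pointwise sum and the combination function is a ReLU-FFNN. -/
def GNNLayer.UsesSumReLU {D D' : ℕ} (L : GNNLayer D D') : Prop :=
  L.agg = Multiset.sum ∧ IsReLUFFNN L.com

/-!
Both claims reduce to building an HE-GNN that counts homomorphisms with arbitrary aggregation
functions. On graphs of degree at most `N` whose nodes initially carry one of finitely many vectors,
only finitely many vectors and multisets of vectors ever occur, and every layer can be simulated by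
two layers with sum aggregation and ReLU networks: one passes to one-hot codes, so that sums
determine multisets, and the other evaluates a function on a finite set
(`HEGNN.exists_sumReLU`, `exists_isReLUFFNN_eqOn`).

For the counting, node functions built from the coordinates by products, (inverses of) sums over the
neighbours, and `d` nested markings of the current node are computed by HE-GNNs of nesting
depth `d` (`NodeFn.exists_hegnn`). It remains to express the homomorphism counts in this way.

Given a dependency function `dep` on `F`, the edges between nodes with the same dependency form a
forest. Directing it towards roots, and taking `dep b` as the parent of a root `b` of the forest,
makes the nodes of `F` into a tree (`IsDepFunction.nonempty_eliminationTree`). The image of `F.root`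
being fixed, the number of homomorphisms is a sum over all maps of a product of factors, one for each
node `b` and one for each tree edge (`EliminationTree.homCount_eq_sum`). The factor of `b` involves
only the images of `b` and of its at most `d` dependencies. Nodes are summed out one after the other,
leaves first (`EliminationTree.exists_isLocal_sum`), while the images of the dependencies of the
current node are marked. Summing out `b` sends a message to its parent
(`EliminationTree.isLocal_message`). Along an edge of the forest, this is a sum over neighbours. If
the parent is `dep b`, then `F` may have no edge between the two, but it has a walk of some length `n`
between them, since it is connected; so the images `x` and `y` are joined by a walk of length `n`,
and it is harmless to add the factor `[there is a walk of length n from x to y]`. With `A` the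
adjacency matrix, this factor equals `(A ^ n) x y * ((A ^ n) y x)⁻¹`. As `x` can be marked, `y` can
compute `(A ^ n) y x`, and `n` rounds of summation deliver the message to `x`.
-/

/-! ### ReLU networks interpolate on finite sets -/

/-- A hidden ReLU layer whose units are indexed by an arbitrary finite type. -/
theorem IsReLUFFNN.relu_of_fintype {n m : ℕ} {K : Type*} [Fintype K]
    (W : Matrix K (Fin n) ℝ) (b : K → ℝ) {g : (K → ℝ) → Fin m → ℝ}
    (hg : IsReLUFFNN fun z : Fin (Fintype.card K) → ℝ => g (z ∘ Fintype.equivFin K)) :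
    IsReLUFFNN fun x => g fun i => max 0 ((W.mulVec x + b) i) := by
  have := IsReLUFFNN.relu (W.submatrix (Fintype.equivFin K).symm id)
    (b ∘ (Fintype.equivFin K).symm) hg
  convert this using 4
  simp [Matrix.mulVec, dotProduct, Function.comp_def]

theorem Matrix.mulVec_comp_equiv {ι K m : Type*} [Fintype ι] [Fintype K]
    (W : Matrix m K ℝ) (e : K ≃ ι) (z : ι → ℝ) :
    W.mulVec (z ∘ e) = (W.submatrix id e.symm).mulVec z := by
  ext i
  simp only [mulVec, dotProduct, Function.comp_apply, submatrix_apply, id]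
  exact Fintype.sum_equiv e _ _ (by simp)

/-- The distances between the points of a finite set are bounded away from `0`. -/
theorem exists_forall_ne_one_le_mul_l1 {n : ℕ} (S : Finset (Fin n → ℝ)) :
    ∃ c : ℝ, ∀ s ∈ S, ∀ t ∈ S, s ≠ t → 1 ≤ c * ∑ i, |s i - t i| := by
  let δ : (Fin n → ℝ) × (Fin n → ℝ) → ℝ := fun q => ∑ i, |q.1 i - q.2 i|
  have hδ : ∀ q, 0 ≤ (δ q)⁻¹ := fun q =>
    inv_nonneg.mpr (Finset.sum_nonneg fun _ _ => abs_nonneg _)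
  refine ⟨∑ q ∈ S ×ˢ S, (δ q)⁻¹, fun s hs t ht hst => ?_⟩
  have hpos : 0 < δ (s, t) := by
    obtain ⟨i, hi⟩ := Function.ne_iff.mp hst
    exact Finset.sum_pos' (fun _ _ => abs_nonneg _)
      ⟨i, Finset.mem_univ _, abs_pos.mpr (sub_ne_zero.mpr hi)⟩
  have hle : (δ (s, t))⁻¹ ≤ ∑ q ∈ S ×ˢ S, (δ q)⁻¹ :=
    Finset.single_le_sum (f := fun q => (δ q)⁻¹) (fun q _ => hδ q) (Finset.mk_mem_product hs ht)
  calc (1 : ℝ) = (δ (s, t))⁻¹ * δ (s, t) := (inv_mul_cancel₀ hpos.ne').symm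
    _ ≤ _ := mul_le_mul_of_nonneg_right hle hpos.le

/-- Every function agrees on a finite set with a ReLU network. Around each point `s` of the set, the
network has the bump `max 0 (1 - c * ‖x - s‖₁)`, where `c` is so large that the bump vanishes at all
other points. -/
theorem exists_isReLUFFNN_eqOn {n m : ℕ} (S : Finset (Fin n → ℝ)) (f : (Fin n → ℝ) → Fin m → ℝ) :
    ∃ g : (Fin n → ℝ) → Fin m → ℝ, IsReLUFFNN g ∧ ∀ x ∈ S, g x = f x := by
  classical
  obtain ⟨c, hc⟩ := exists_forall_ne_one_le_mul_l1 S
  -- Units `max 0 (x i - s i)` and `max 0 (s i - x i)`, whose sum is `|x i - s i|`.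
  let W₁ : Matrix (S × Fin n × Bool) (Fin n) ℝ := fun k j =>
    if j = k.2.1 then (if k.2.2 then 1 else -1) else 0
  let b₁ : S × Fin n × Bool → ℝ := fun k => if k.2.2 then -(k.1.1 k.2.1) else k.1.1 k.2.1
  let W₂ : Matrix S (S × Fin n × Bool) ℝ := fun s k => if k.1 = s then -c else 0
  let W₃ : Matrix (Fin m) S ℝ := fun i s => f s.1 i
  have h₃ : IsReLUFFNN fun z : Fin (Fintype.card S) → ℝ =>
      W₃.mulVec (z ∘ Fintype.equivFin S) := by
    have := IsReLUFFNN.output (W₃.submatrix id (Fintype.equivFin S).symm) 0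
    simpa only [Matrix.mulVec_comp_equiv, add_zero] using this
  have h₂ : IsReLUFFNN fun z : Fin (Fintype.card (S × Fin n × Bool)) → ℝ =>
      W₃.mulVec fun s => max 0 ((W₂.mulVec (z ∘ Fintype.equivFin _) + 1) s) := by
    simp only [Matrix.mulVec_comp_equiv]
    exact IsReLUFFNN.relu_of_fintype _ 1 h₃
  refine ⟨_, IsReLUFFNN.relu_of_fintype W₁ b₁
    (g := fun z => W₃.mulVec fun s => max 0 ((W₂.mulVec z + 1) s)) h₂, fun x hx => ?_⟩
  have habs : ∀ a b : ℝ, max 0 (a + -b) + max 0 (-a + b) = |a - b| := by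
    intro a b
    rcases le_total a b with h | h
    · rw [max_eq_left (by linarith), max_eq_right (by linarith), abs_of_nonpos (by linarith)]; ring
    · rw [max_eq_right (by linarith), max_eq_left (by linarith), abs_of_nonneg (by linarith)]; ring
  have hW₂ : ∀ s : S, W₂.mulVec (fun i => max 0 ((W₁.mulVec x + b₁) i)) s
      = - (c * ∑ i, |x i - s.1 i|) := by
    intro s
    simp only [Matrix.mulVec, dotProduct, W₂, W₁, b₁, Fintype.sum_prod_type, Pi.add_apply, ite_mul,
      zero_mul, Finset.sum_ite_eq', Finset.mem_univ, if_true, Fintype.sum_bool]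
    simp [Finset.mul_sum, ← habs, Finset.sum_add_distrib, mul_add]
    ring
  have hbump : (fun s : S => max 0 ((W₂.mulVec (fun i => max 0 ((W₁.mulVec x + b₁) i)) + 1) s))
      = Pi.single ⟨x, hx⟩ 1 := by
    funext s
    rw [Pi.add_apply, hW₂, Pi.one_apply]
    by_cases h : s = ⟨x, hx⟩
    · subst h; simp
    · rw [Pi.single_eq_of_ne h, max_eq_left]
      have := hc x hx s.1 s.2 fun h' => h (Subtype.ext h'.symm)
      linarith
  ext i
  simp only [hbump]
  exact congrFun (Matrix.mulVec_single_one W₃ _) i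

/-! ### Simulation on graphs of bounded degree -/

open Classical in
/-- The multiset of the embeddings of the neighbours of `x`, which a layer aggregates. -/
noncomputable def LGraph.nbrEmb {p D : ℕ} (G : LGraph.{v} p) (emb : G.V → Fin D → ℝ) (x : G.V) :
    Multiset (Fin D → ℝ) :=
  (Finset.univ.filter fun y => G.graph.Adj x y).val.map emb

theorem GNNLayer.run_eq {p D D' : ℕ} (L : GNNLayer D D') (G : LGraph.{v} p)
    (emb : G.V → Fin D → ℝ) (x : G.V) :
    L.run G emb x = L.com (Fin.append (emb x) (L.agg (G.nbrEmb emb x))) := rfl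

/-- The degree of every node is at most `N`. -/
def LGraph.DegreeLE {p : ℕ} (G : LGraph.{v} p) (N : ℕ) : Prop :=
  ∀ w : G.V, (G.graph.neighborSet w).ncard ≤ N

theorem LGraph.DegreeLE.card_nbrEmb {p D N : ℕ} {G : LGraph.{v} p} (hG : G.DegreeLE N)
    (emb : G.V → Fin D → ℝ) (x : G.V) : (G.nbrEmb emb x).card ≤ N := by
  classical
  have h := hG x
  rw [Set.ncard_eq_toFinset_card'] at h
  rw [nbrEmb, Multiset.card_map]
  refine le_trans (le_of_eq ?_) h
  change Finset.card _ = _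
  congr 1
  ext y
  simp

theorem LGraph.mem_of_mem_nbrEmb {p D : ℕ} {G : LGraph.{v} p} {emb : G.V → Fin D → ℝ} {x : G.V}
    {S : Finset (Fin D → ℝ)} (h : ∀ y, emb y ∈ S) : ∀ a ∈ G.nbrEmb emb x, a ∈ S := by
  intro a ha
  obtain ⟨y, -, rfl⟩ := Multiset.mem_map.mp ha
  exact h y

theorem Finset.finite_multiset_card_le {α : Type*} (S : Finset α) (N : ℕ) :
    {m : Multiset α | (∀ a ∈ m, a ∈ S) ∧ m.card ≤ N}.Finite := by
  classical
  refine (Set.finite_Iic (N • S.val)).subset fun m hm => ?_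
  refine Set.mem_Iic.mpr (Multiset.le_iff_count.mpr fun a => ?_)
  by_cases ha : a ∈ m
  · have : Multiset.count a S.val = 1 := Multiset.count_eq_one_of_mem S.nodup (hm.1 a ha)
    rw [Multiset.count_nsmul, this, mul_one]
    exact (Multiset.count_le_card a m).trans hm.2
  · simp [Multiset.count_eq_zero_of_notMem ha]

/-- A layer with arbitrary aggregation and combination functions is simulated by two layers with sum
aggregation and ReLU networks, on graphs of bounded degree and finitely many input embeddings. The
first layer maps each embedding to its one-hot code; the sum of the codes of the neighbours then
determines the multiset of their embeddings. -/
theorem GNNLayer.exists_sumReLU {D D' : ℕ} (L : GNNLayer D D') (S : Finset (Fin D → ℝ)) (N : ℕ) :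
    ∃ (m : ℕ) (_ : 1 ≤ m) (L₁ : GNNLayer D m) (L₂ : GNNLayer m D') (S' : Finset (Fin D' → ℝ)),
      L₁.UsesSumReLU ∧ L₂.UsesSumReLU ∧
      ∀ {p : ℕ} (G : LGraph.{v} p), G.DegreeLE N → ∀ emb : G.V → Fin D → ℝ, (∀ y, emb y ∈ S) →
        L₂.run G (L₁.run G emb) = L.run G emb ∧ ∀ y, L.run G emb y ∈ S' := by
  classical
  let T := insert 0 S
  let e := Fintype.equivFin T
  let m := Fintype.card T
  have hm : 1 ≤ m := Fintype.card_pos_iff.mpr ⟨⟨0, Finset.mem_insert_self _ _⟩⟩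
  let enc : (Fin D → ℝ) → Fin m → ℝ := fun x j => if x = (e.symm j).1 then 1 else 0
  let A : Set ((Fin D → ℝ) × Multiset (Fin D → ℝ)) :=
    (T : Set _) ×ˢ {μ | (∀ a ∈ μ, a ∈ T) ∧ μ.card ≤ N}
  have hA : A.Finite := T.finite_toSet.prod (T.finite_multiset_card_le N)
  let code : (Fin D → ℝ) × Multiset (Fin D → ℝ) → Fin (m + m) → ℝ :=
    fun q => Fin.append (enc q.1) (q.2.map enc).sum
  have hsum : ∀ (μ : Multiset (Fin D → ℝ)) j, (μ.map enc).sum j = μ.count (e.symm j).1 := by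
    intro μ j
    induction μ using Multiset.induction with
    | empty => simp
    | cons a μ ih =>
      rw [Multiset.map_cons, Multiset.sum_cons, Pi.add_apply, ih, Multiset.count_cons]
      by_cases h : a = (e.symm j).1
      · simp only [enc, if_pos h, if_pos h.symm]; push_cast; ring
      · simp only [enc, if_neg h, if_neg (Ne.symm h)]; push_cast; ring
  have hcode : Set.InjOn code A := by
    rintro ⟨x, μ⟩ ⟨hx, hμ⟩ ⟨y, ν⟩ ⟨hy, hν⟩ hxy
    have hx' : x ∈ T := hx
    refine Prod.ext ?_ ?_
    · have := congrFun hxy (Fin.castAdd m (e ⟨x, hx'⟩))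
      simp only [code, Fin.append_left, enc, Equiv.symm_apply_apply, if_true] at this
      by_contra hne
      rw [if_neg fun h => hne h.symm] at this
      exact one_ne_zero this
    · refine Multiset.ext.mpr fun a => ?_
      by_cases ha : a ∈ T
      · have := congrFun hxy (Fin.natAdd m (e ⟨a, ha⟩))
        simpa only [code, Fin.append_right, hsum, Equiv.symm_apply_apply, Nat.cast_inj] using this
      · rw [Multiset.count_eq_zero_of_notMem fun h => ha (hμ.1 a h),
          Multiset.count_eq_zero_of_notMem fun h => ha (hν.1 a h)]
  let out : (Fin D → ℝ) × Multiset (Fin D → ℝ) → Fin D' → ℝ :=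
    fun q => L.com (Fin.append q.1 (L.agg q.2))
  -- The first layer has to work on `Fin.append x s` for every sum `s` of at most `N` neighbours.
  obtain ⟨c₁, hc₁, hc₁'⟩ := exists_isReLUFFNN_eqOn
    (hA.toFinset.image fun q => Fin.append q.1 q.2.sum)
    (fun z => enc fun i => z (Fin.castAdd D i))
  obtain ⟨c₂, hc₂, hc₂'⟩ := exists_isReLUFFNN_eqOn (hA.toFinset.image code)
    (out ∘ Function.invFunOn code A)
  refine ⟨m, hm, ⟨Multiset.sum, c₁⟩, ⟨Multiset.sum, c₂⟩, hA.toFinset.image out, ⟨rfl, hc₁⟩,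
    ⟨rfl, hc₂⟩, fun {p} G hG emb hemb => ?_⟩
  have hmem : ∀ x, (emb x, G.nbrEmb emb x) ∈ A := fun x =>
    ⟨Finset.mem_insert_of_mem (hemb x),
      LGraph.mem_of_mem_nbrEmb fun y => Finset.mem_insert_of_mem (hemb y), hG.card_nbrEmb emb x⟩
  have h₁ : GNNLayer.run ⟨Multiset.sum, c₁⟩ G emb = enc ∘ emb := by
    funext x
    rw [GNNLayer.run_eq]
    dsimp only
    rw [hc₁' _ (Finset.mem_image.mpr ⟨_, hA.mem_toFinset.mpr (hmem x), rfl⟩)]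
    simp
  refine ⟨?_, fun y => Finset.mem_image.mpr ⟨_, hA.mem_toFinset.mpr (hmem y), rfl⟩⟩
  rw [h₁]
  funext x
  have h₂ : Fin.append ((enc ∘ emb) x) (G.nbrEmb (enc ∘ emb) x).sum
      = code (emb x, G.nbrEmb emb x) := by
    simp [code, LGraph.nbrEmb, Multiset.map_map]
  rw [GNNLayer.run_eq]
  dsimp only
  rw [h₂, hc₂' _ (Finset.mem_image.mpr ⟨_, hA.mem_toFinset.mpr (hmem x), rfl⟩),
    Function.comp_apply, hcode.leftInvOn_invFunOn (hmem x)]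
  rfl

theorem GNN.exists_sumReLU {D D' : ℕ} (A : GNN D D') (N : ℕ) (S : Finset (Fin D → ℝ)) :
    ∃ (B : GNN D D') (S' : Finset (Fin D' → ℝ)), B.AllLayers (fun L => L.UsesSumReLU) ∧
      ∀ {p : ℕ} (G : LGraph.{v} p), G.DegreeLE N → ∀ emb : G.V → Fin D → ℝ, (∀ y, emb y ∈ S) →
        B.run G emb = A.run G emb ∧ ∀ y, A.run G emb y ∈ S' := by
  induction A with
  | last L =>
    obtain ⟨m, hm, L₁, L₂, S', h₁, h₂, h⟩ := L.exists_sumReLU S N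
    exact ⟨.cons hm L₁ (.last L₂), S', ⟨h₁, h₂⟩, h⟩
  | cons hE L A ih =>
    obtain ⟨m, hm, L₁, L₂, S₁, h₁, h₂, h⟩ := L.exists_sumReLU S N
    obtain ⟨B, S', hB, h'⟩ := ih S₁
    refine ⟨.cons hm L₁ (.cons hE L₂ B), S', ⟨h₁, h₂, hB⟩, fun G hG emb hemb => ?_⟩
    obtain ⟨hL, hS₁⟩ := h G hG emb hemb
    simp only [GNN.run, hL]
    exact h' G hG _ hS₁

/-- On graphs of bounded degree and finitely many input embeddings, every HE-GNN is simulated by one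
with sum aggregation and ReLU networks. -/
theorem HEGNN.exists_sumReLU {d D D' : ℕ} (A : HEGNN d D D') (N : ℕ) (S : Finset (Fin D → ℝ)) :
    ∃ (B : HEGNN d D D') (S' : Finset (Fin D' → ℝ)), B.AllLayers (fun L => L.UsesSumReLU) ∧
      ∀ {p : ℕ} (G : LGraph.{v} p), G.DegreeLE N → ∀ emb : G.V → Fin D → ℝ, (∀ y, emb y ∈ S) →
        B.run G emb = A.run G emb ∧ ∀ y, A.run G emb y ∈ S' := by
  classical
  induction A with
  | base C =>
    obtain ⟨B, S', hB, h⟩ := C.exists_sumReLU N S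
    exact ⟨.base B, S', hB, h⟩
  | @ego d D D'' D' A C ih =>
    obtain ⟨B, S₁, hB, h⟩ := ih
      ((S ×ˢ {0, 1}).image fun q : (Fin D → ℝ) × ℝ => Fin.append q.1 fun _ : Fin 1 => q.2)
    obtain ⟨C', S', hC', h'⟩ := C.exists_sumReLU N
      ((S ×ˢ S₁).image fun q : (Fin D → ℝ) × (Fin D'' → ℝ) => Fin.append q.1 q.2)
    refine ⟨.ego B C', S', ⟨hB, hC'⟩, fun G hG emb hemb => ?_⟩
    have hmark : ∀ x y, markNode G emb x y ∈
        (S ×ˢ {0, 1}).image fun q : (Fin D → ℝ) × ℝ => Fin.append q.1 fun _ : Fin 1 => q.2 :=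
      fun x y => Finset.mem_image.mpr ⟨(emb y, if y = x then 1 else 0), by
        simp only [Finset.mem_product, hemb, true_and]; split_ifs <;> simp, rfl⟩
    have hrun : ∀ x, B.run G (markNode G emb x) = A.run G (markNode G emb x) := fun x =>
      (h G hG _ (hmark x)).1
    simp only [HEGNN.run, hrun]
    exact h' G hG _ fun x => Finset.mem_image.mpr
      ⟨(emb x, A.run G (markNode G emb x) x),
        Finset.mem_product.mpr ⟨hemb x, (h G hG _ (hmark x)).2 x⟩, rfl⟩

/-! ### A calculus of functions computed by HE-GNNs -/

/-- A real-valued node function of a graph with a `D`-dimensional embedding. -/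
abbrev NodeFn (p D : ℕ) : Type (v + 1) := ∀ G : LGraph.{v} p, (G.V → Fin D → ℝ) → G.V → ℝ

namespace NodeFn

variable {p D : ℕ}

/-- The `n`-th coordinate of the embedding; it is constantly `0` for `n ≥ D`. -/
def coord (p D n : ℕ) : NodeFn.{v} p D := fun _ emb x => if h : n < D then emb x ⟨n, h⟩ else 0

open Classical in
/-- The sum of `f` over the neighbours of a node. -/
noncomputable def nbrSum (f : NodeFn.{v} p D) : NodeFn.{v} p D :=
  fun G emb x => ∑ y with G.graph.Adj x y, f G emb y

theorem nbrSum_eq_nbrEmb_sum {E : ℕ} (X : Fin E → NodeFn.{v} p D) (i : Fin E) (G : LGraph.{v} p)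
    (emb : G.V → Fin D → ℝ) (x : G.V) :
    (X i).nbrSum G emb x = (G.nbrEmb (fun y j => X j G emb y) x).sum i := by
  simp only [nbrSum, LGraph.nbrEmb]
  exact (Finset.sum_apply i _ fun y j => X j G emb y).symm

/-- The value of `f` at `x` on the graph in which `x` is marked. -/
noncomputable def ego (f : NodeFn.{v} p (D + 1)) : NodeFn.{v} p D :=
  fun G emb x => f G (markNode G emb x) x

/-- The closure of a set of node functions under constants, products, summation over the neighbours,
and the inverse of the sum over the neighbours (where `0⁻¹ = 0`). -/
inductive Generated (I : Set (NodeFn.{v} p D)) : NodeFn.{v} p D → Prop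
  | of {f} (hf : f ∈ I) : Generated I f
  | const (c : ℝ) : Generated I fun _ _ _ => c
  | mul {f g} (hf : Generated I f) (hg : Generated I g) :
      Generated I fun G emb x => f G emb x * g G emb x
  | nbrSum {f} (hf : Generated I f) : Generated I f.nbrSum
  | invNbrSum {f} (hf : Generated I f) : Generated I fun G emb x => (f.nbrSum G emb x)⁻¹

/-- The node functions that are expressible with `d` nested uses of `NodeFn.ego`. -/
def Expressible {p : ℕ} : (d D : ℕ) → NodeFn.{v} p D → Prop
  | 0, _ => Generated (Set.range fun i _ emb x => emb x i)
  | d + 1, D => Generated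
      ((Set.range fun i _ emb x => emb x i) ∪ ego '' {f | Expressible d (D + 1) f})

/-- The closure only uses finitely many of the generators. -/
theorem Generated.exists_finite {I : Set (NodeFn.{v} p D)} {f : NodeFn.{v} p D}
    (hf : Generated I f) : ∃ J ⊆ I, J.Finite ∧ ∀ J' ⊇ J, Generated J' f := by
  induction hf with
  | of hf => exact ⟨{_}, by simpa using hf, Set.finite_singleton _, fun J' h => .of (h rfl)⟩
  | const c => exact ⟨∅, Set.empty_subset _, Set.finite_empty, fun _ _ => .const c⟩
  | mul _ _ ih₁ ih₂ =>
    obtain ⟨J₁, h₁, hf₁, h₁'⟩ := ih₁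
    obtain ⟨J₂, h₂, hf₂, h₂'⟩ := ih₂
    exact ⟨J₁ ∪ J₂, Set.union_subset h₁ h₂, hf₁.union hf₂, fun J' h =>
      .mul (h₁' _ (Set.subset_union_left.trans h)) (h₂' _ (Set.subset_union_right.trans h))⟩
  | nbrSum _ ih =>
    obtain ⟨J, h, hf, h'⟩ := ih
    exact ⟨J, h, hf, fun J' hJ => .nbrSum (h' J' hJ)⟩
  | invNbrSum _ ih =>
    obtain ⟨J, h, hf, h'⟩ := ih
    exact ⟨J, h, hf, fun J' hJ => .invNbrSum (h' J' hJ)⟩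

end NodeFn

/-! ### Compiling node functions into HE-GNNs -/

/-- The composition of two GNNs. -/
def GNN.comp {E D' : ℕ} (hE : 1 ≤ E) (B : GNN E D') : {D : ℕ} → GNN D E → GNN D D'
  | _, .last L => .cons hE L B
  | _, .cons h L A => .cons h L (comp hE B A)

theorem GNN.run_comp {p D E D' : ℕ} (hE : 1 ≤ E) (A : GNN D E) (B : GNN E D') (G : LGraph.{v} p)
    (emb : G.V → Fin D → ℝ) : (comp hE B A).run G emb = B.run G (A.run G emb) := by
  induction A with
  | last L => rfl
  | cons h L A ih => exact ih hE B _

theorem GNN.AllLayers.comp {Q : ∀ {D D' : ℕ}, GNNLayer D D' → Prop} {D E D' : ℕ} (hE : 1 ≤ E)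
    {A : GNN D E} {B : GNN E D'} (hA : A.AllLayers Q) (hB : B.AllLayers Q) :
    (GNN.comp hE B A).AllLayers Q := by
  induction A with
  | last L => exact ⟨hA, hB⟩
  | cons h L A ih => exact ⟨hA.1, ih hE hA.2 hB⟩

/-- An affine combination function that reads off coordinates. -/
theorem IsReLUMulFFNN.reindex {n m : ℕ} (σ : Fin m → Fin n) :
    IsReLUMulFFNN fun x : Fin n → ℝ => x ∘ σ := by
  have := IsReLUMulFFNN.output ((1 : Matrix (Fin n) (Fin n) ℝ).submatrix σ id) 0
  convert this using 2 with x
  ext i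
  simp [Matrix.mulVec, dotProduct, Matrix.one_apply]

/-- The affine functions of the inputs. -/
def IsAffineForm {n : ℕ} (f : (Fin n → ℝ) → ℝ) : Prop :=
  ∃ (w : Fin n → ℝ) (b : ℝ), ∀ x, f x = w ⬝ᵥ x + b

theorem isAffineForm_coord {n : ℕ} (i : Fin n) : IsAffineForm fun x : Fin n → ℝ => x i :=
  ⟨Pi.single i 1, 0, fun x => by simp⟩

theorem isAffineForm_const {n : ℕ} (c : ℝ) : IsAffineForm fun _ : Fin n → ℝ => c :=
  ⟨0, c, fun x => by simp⟩

/-- A function whose coordinates are products of two affine forms is a multiplication network. -/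
theorem IsReLUMulFFNN.of_isAffineForm {n m : ℕ} {f g : Fin m → (Fin n → ℝ) → ℝ}
    (hf : ∀ i, IsAffineForm (f i)) (hg : ∀ i, IsAffineForm (g i)) :
    IsReLUMulFFNN fun x i => f i x * g i x := by
  choose w b h using hf
  choose w' b' h' using hg
  have := IsReLUMulFFNN.mul (Matrix.of w) (Matrix.of w') b b' (g := fun x => x) (.reindex id)
  convert this using 3 with x i
  rw [h, h']
  rfl

section Compile

variable {p D : ℕ}

/-- The GNN, applied to the embedding given by the node functions `X i`, returns the embedding given
by the node functions `Y j`. -/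
def GNN.Computes {E E' : ℕ} (A : GNN E E') (X : Fin E → NodeFn.{v} p D)
    (Y : Fin E' → NodeFn.{v} p D) : Prop :=
  ∀ G emb, A.run G (fun x i => X i G emb x) = fun x j => Y j G emb x

/-- A layer that keeps all coordinates and appends one, the product of two affine forms in the
embedding and the aggregated vector. -/
theorem exists_computes_snoc {E : ℕ} (X : Fin E → NodeFn.{v} p D)
    (agg : Multiset (Fin E → ℝ) → Fin E → ℝ) {f g : (Fin (E + E) → ℝ) → ℝ}
    (hf : IsAffineForm f) (hg : IsAffineForm g) :
    ∃ A : GNN E (E + 1), A.AllLayers (fun L => L.UsesReLUMul) ∧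
      A.Computes X (Fin.snoc X fun G emb x =>
        let z := Fin.append (fun i => X i G emb x)
          (agg (G.nbrEmb (fun x i => X i G emb x) x))
        f z * g z) := by
  refine ⟨.last ⟨agg, fun z i =>
      Fin.snoc (α := fun _ => (Fin (E + E) → ℝ) → ℝ) (fun j z => z (Fin.castAdd E j)) f i z *
      Fin.snoc (α := fun _ => (Fin (E + E) → ℝ) → ℝ) (fun _ _ => 1) g i z⟩,
    IsReLUMulFFNN.of_isAffineForm (fun i => ?_) (fun i => ?_), fun G emb => ?_⟩
  · induction i using Fin.lastCases with
    | last => simpa using hf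
    | cast j => simpa using isAffineForm_coord _
  · induction i using Fin.lastCases with
    | last => simpa using hg
    | cast j => simpa using isAffineForm_const 1
  · funext x i
    rw [GNN.run, GNNLayer.run_eq]
    induction i using Fin.lastCases with
    | last => simp
    | cast j => simp

/-- Every generated node function becomes a coordinate of the output of a GNN that keeps all its
input coordinates. -/
theorem NodeFn.Generated.exists_computes {J : Set (NodeFn.{v} p D)} {f : NodeFn.{v} p D}
    (hf : Generated J f) : ∀ {E : ℕ} (X : Fin E → NodeFn.{v} p D), J ⊆ Set.range X →
      ∃ (E' : ℕ) (Y : Fin E' → NodeFn.{v} p D) (A : GNN E E'),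
        A.AllLayers (fun L => L.UsesReLUMul) ∧ A.Computes X Y ∧
        Set.range X ⊆ Set.range Y ∧ f ∈ Set.range Y := by
  -- A single layer suffices if `f` results from one operation on the coordinates.
  have snoc : ∀ {E : ℕ} (X : Fin E → NodeFn.{v} p D) (f : NodeFn.{v} p D),
      (∃ A : GNN E (E + 1), A.AllLayers (fun L => L.UsesReLUMul) ∧ A.Computes X (Fin.snoc X f)) →
      ∃ (E' : ℕ) (Y : Fin E' → NodeFn.{v} p D) (A : GNN E E'),
        A.AllLayers (fun L => L.UsesReLUMul) ∧ A.Computes X Y ∧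
        Set.range X ⊆ Set.range Y ∧ f ∈ Set.range Y := by
    rintro E X f ⟨A, hA, h⟩
    refine ⟨_, _, A, hA, h, ?_, ⟨Fin.last E, by simp⟩⟩
    rintro _ ⟨i, rfl⟩
    exact ⟨i.castSucc, by simp⟩
  have comp : ∀ {E E₁ : ℕ} {X : Fin E → NodeFn.{v} p D} {Y : Fin E₁ → NodeFn.{v} p D}
      {f g : NodeFn.{v} p D} (A : GNN E E₁), A.AllLayers (fun L => L.UsesReLUMul) →
      A.Computes X Y → Set.range X ⊆ Set.range Y → f ∈ Set.range Y →
      (∃ (E' : ℕ) (Z : Fin E' → NodeFn.{v} p D) (B : GNN E₁ E'),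
        B.AllLayers (fun L => L.UsesReLUMul) ∧ B.Computes Y Z ∧
        Set.range Y ⊆ Set.range Z ∧ g ∈ Set.range Z) →
      ∃ (E' : ℕ) (Z : Fin E' → NodeFn.{v} p D) (B : GNN E E'),
        B.AllLayers (fun L => L.UsesReLUMul) ∧ B.Computes X Z ∧
        Set.range X ⊆ Set.range Z ∧ f ∈ Set.range Z ∧ g ∈ Set.range Z := by
    rintro E E₁ X Y f g A hA hXY hX hf ⟨E', Z, B, hB, hYZ, hY, hg⟩
    have hE : 1 ≤ E₁ := by
      obtain ⟨i, -⟩ := hf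
      exact i.pos
    refine ⟨E', Z, GNN.comp hE B A, hA.comp hE hB, fun G emb => ?_, hX.trans hY, hY hf, hg⟩
    rw [GNN.run_comp, hXY, hYZ]
  induction hf with
  | of hf =>
    intro E X hJ
    refine ⟨E, X, .last ⟨fun _ => 0, fun z => z ∘ Fin.castAdd E⟩, IsReLUMulFFNN.reindex _,
      fun G emb => ?_, subset_rfl, hJ hf⟩
    funext x i
    simp [GNN.run, GNNLayer.run_eq]
  | const c =>
    intro E X _
    refine snoc X _ ?_
    convert exists_computes_snoc X (fun _ => 0) (isAffineForm_const c) (isAffineForm_const 1) using 6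
    simp
  | @mul f g _ _ ih₁ ih₂ =>
    intro E X hJ
    obtain ⟨E₁, Y, A, hA, hXY, hX, hf⟩ := ih₁ X hJ
    obtain ⟨E₂, Z, B, hB, hXZ, hX', ⟨i, rfl⟩, ⟨j, rfl⟩⟩ :=
      comp A hA hXY hX hf (ih₂ Y (hJ.trans hX))
    obtain ⟨E', Y', B', hB', h, hXY', -, hg'⟩ := comp B hB hXZ hX' ⟨i, rfl⟩
      (snoc Z _ (exists_computes_snoc Z (fun _ => 0)
        (isAffineForm_coord (Fin.castAdd _ i)) (isAffineForm_coord (Fin.castAdd _ j))))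
    exact ⟨E', Y', B', hB', h, hXY', by simpa using hg'⟩
  | @nbrSum f _ ih =>
    intro E X hJ
    obtain ⟨E₁, Y, A, hA, hXY, hX, ⟨i, rfl⟩⟩ := ih X hJ
    obtain ⟨E', Y', B', hB', h, hXY', -, hg'⟩ := comp A hA hXY hX ⟨i, rfl⟩
      (snoc Y _ (exists_computes_snoc Y Multiset.sum
        (isAffineForm_coord (Fin.natAdd _ i)) (isAffineForm_const 1)))
    refine ⟨E', Y', B', hB', h, hXY', ?_⟩
    convert hg' using 1
    funext G emb x
    simp only [Fin.append_right, mul_one, NodeFn.nbrSum_eq_nbrEmb_sum]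
  | @invNbrSum f _ ih =>
    intro E X hJ
    obtain ⟨E₁, Y, A, hA, hXY, hX, ⟨i, rfl⟩⟩ := ih X hJ
    obtain ⟨E', Y', B', hB', h, hXY', -, hg'⟩ := comp A hA hXY hX ⟨i, rfl⟩
      (snoc Y _ (exists_computes_snoc Y (fun μ j => (μ.sum j)⁻¹)
        (isAffineForm_coord (Fin.natAdd _ i)) (isAffineForm_const 1)))
    refine ⟨E', Y', B', hB', h, hXY', ?_⟩
    convert hg' using 1
    funext G emb x
    simp only [Fin.append_right, mul_one, NodeFn.nbrSum_eq_nbrEmb_sum]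

/-- A finite family of generated node functions is the output of a GNN. -/
theorem NodeFn.exists_gnn {J : Set (NodeFn.{v} p D)} {E k : ℕ} (X : Fin E → NodeFn.{v} p D)
    (hJ : J ⊆ Set.range X) (f : Fin k → NodeFn.{v} p D) (hf : ∀ i, Generated J (f i)) :
    ∃ A : GNN E k, A.AllLayers (fun L => L.UsesReLUMul) ∧ A.Computes X f := by
  have key : ∀ s : Finset (Fin k), ∃ (E' : ℕ) (_ : 1 ≤ E') (Y : Fin E' → NodeFn.{v} p D)
      (A : GNN E E'), A.AllLayers (fun L => L.UsesReLUMul) ∧ A.Computes X Y ∧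
      Set.range X ⊆ Set.range Y ∧ ∀ i ∈ s, f i ∈ Set.range Y := by
    intro s
    induction s using Finset.induction with
    | empty =>
      obtain ⟨E', Y, A, hA, h, hX, ⟨i, -⟩⟩ := (Generated.const (I := J) 0).exists_computes X hJ
      exact ⟨E', i.pos, Y, A, hA, h, hX, by simp⟩
    | insert i s _ ih =>
      obtain ⟨E₁, hE₁, Y, A, hA, hXY, hX, hs⟩ := ih
      obtain ⟨E', Z, B, hB, hYZ, hY, hi⟩ := (hf i).exists_computes Y (hJ.trans hX)
      refine ⟨E', hi.choose.pos, Z, GNN.comp hE₁ B A, hA.comp hE₁ hB, fun G emb => ?_,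
        hX.trans hY, fun j hj => ?_⟩
      · rw [GNN.run_comp, hXY, hYZ]
      · rcases Finset.mem_insert.mp hj with rfl | hj
        exacts [hi, hY (hs j hj)]
  obtain ⟨E', hE', Y, A, hA, hXY, -, hY⟩ := key Finset.univ
  choose σ hσ using fun i => hY i (Finset.mem_univ i)
  refine ⟨GNN.comp hE' (.last ⟨fun _ => 0, fun z => z ∘ (Fin.castAdd E' ∘ σ)⟩) A,
    hA.comp hE' (IsReLUMulFFNN.reindex _), fun G emb => ?_⟩
  rw [GNN.run_comp, hXY]
  funext x i
  simp [GNN.run, GNNLayer.run_eq, hσ]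

/-- A finite family of node functions expressible with `d` nested egos is the output of an HE-GNN of
nesting depth `d`. -/
theorem NodeFn.exists_hegnn {d k : ℕ} (f : Fin k → NodeFn.{v} p D)
    (hf : ∀ i, Expressible d D (f i)) :
    ∃ A : HEGNN d D k, A.AllLayers (fun L => L.UsesReLUMul) ∧
      ∀ G emb x, A.run G emb x = fun i => f i G emb x := by
  induction d generalizing D k with
  | zero =>
    obtain ⟨C, hC, h⟩ := exists_gnn (fun i _ emb x => emb x i) subset_rfl f hf
    exact ⟨.base C, hC, fun G emb x => congrFun (h G emb) x⟩
  | succ d ih =>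
    choose J hJ hfin hgen using fun i => Generated.exists_finite (hf i)
    -- The functions in `g` are those to which `ego` is applied.
    obtain ⟨m, g, hg, hJg⟩ : ∃ (m : ℕ) (g : Fin m → NodeFn.{v} p (D + 1)),
        (∀ j, Expressible d (D + 1) (g j)) ∧
        ∀ i, J i ⊆ (Set.range fun i _ emb x => emb x i) ∪ Set.range fun j => ego (g j) := by
      have hfin' : ((⋃ i, J i) ∩ ego '' {f | Expressible d (D + 1) f}).Finite :=
        (Set.finite_iUnion hfin).inter_of_left _
      obtain ⟨m, e, -, he⟩ := hfin'.fin_param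
      choose g hg hge using fun j => (he.subset (Set.mem_range_self j)).2
      refine ⟨m, g, hg, fun i f hf => (hJ i hf).imp_right fun h => ?_⟩
      obtain ⟨j, rfl⟩ := he.superset ⟨Set.mem_iUnion.mpr ⟨i, hf⟩, h⟩
      exact ⟨j, hge j⟩
    obtain ⟨B, hB, hBrun⟩ := ih g hg
    obtain ⟨C, hC, h⟩ := exists_gnn (D := D)
      (Fin.append (fun i _ emb x => emb x i) fun j => ego (g j))
      (J := (Set.range fun i _ emb x => emb x i) ∪ Set.range fun j => ego (g j))
      (by
        rintro _ (⟨i, rfl⟩ | ⟨j, rfl⟩)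
        · exact ⟨Fin.castAdd m i, by simp⟩
        · exact ⟨Fin.natAdd D j, by simp⟩) f (fun i => hgen i _ (hJg i))
    refine ⟨.ego B C, ⟨hB, hC⟩, fun G emb x => ?_⟩
    rw [HEGNN.run, ← congrFun (h G emb) x]
    congr 1
    funext x i
    induction i using Fin.addCases with
    | left i => simp
    | right j => simp [hBrun, ego]

end Compile

/-! ### Elimination trees -/

/-- The edges of an acyclic graph can be directed towards roots, one in each connected component,
where any given node `u` may be chosen as the root of its component. Here `t` is the distance to the
root. -/
theorem SimpleGraph.IsAcyclic.exists_orientation {V : Type*} {T : SimpleGraph V} (hT : T.IsAcyclic)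
    (u : V) : ∃ (par : V → Option V) (t : V → ℕ),
      (∀ b, T.Reachable u b → par b = none → b = u) ∧
      (∀ b a, par b = some a → b ≠ u ∧ T.Adj b a ∧ t a < t b) ∧
      ∀ a b, T.Adj a b → par a = some b ∨ par b = some a := by
  classical
  let R : V → V := fun b => if T.Reachable u b then u else (T.connectedComponentMk b).out
  have hR : ∀ b, T.Reachable (R b) b := by
    intro b
    simp only [R]
    split_ifs with h
    · exact h
    · exact ConnectedComponent.exact (Quot.out_eq (T.connectedComponentMk b))
  have hRadj : ∀ a b, T.Adj a b → R a = R b := by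
    intro a b hab
    have h₁ : T.Reachable u a ↔ T.Reachable u b :=
      ⟨fun h => h.trans hab.reachable, fun h => h.trans hab.symm.reachable⟩
    have h₂ : T.connectedComponentMk a = T.connectedComponentMk b :=
      ConnectedComponent.sound hab.reachable
    simp only [R, h₁, h₂]
  have hRu : R u = u := if_pos (Reachable.refl u)
  choose q hq using fun b => (hR b).exists_isPath
  have huniq : ∀ b (r : T.Walk (R b) b), r.IsPath → r = q b := fun b r hr =>
    congrArg Subtype.val ((hT.subsingleton_path (R b) b).elim ⟨r, hr⟩ ⟨q b, hq b⟩)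
  have hlen : ∀ b x (r : T.Walk x b), x = R b → r.IsPath → r.length = (q b).length := by
    rintro b x r rfl hr
    rw [huniq b r hr]
  have hpen : ∀ b x (r : T.Walk x b), x = R b → r.IsPath → r.penultimate = (q b).penultimate := by
    rintro b x r rfl hr
    rw [huniq b r hr]
  refine ⟨fun b => if R b = b then none else some (q b).penultimate, fun b => (q b).length, ?_, ?_,
    ?_⟩
  · intro b hb h
    by_cases hRb : R b = b
    · rw [← hRb]
      exact if_pos hb
    · simp [hRb] at h
  · intro b a h
    by_cases hRb : R b = b
    · simp [hRb] at h
    simp only [if_neg hRb, Option.some_inj] at h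
    subst h
    have hnil : ¬ (q b).Nil := fun h => hRb h.eq
    have hadj := (q b).adj_penultimate hnil
    refine ⟨fun h => hRb (by rw [h, hRu]), hadj.symm, ?_⟩
    have hlt := hlen _ _ (q b).dropLast (hRadj _ _ hadj.symm) (hq b).dropLast
    have := (q b).length_dropLast_add_one hnil
    dsimp only
    omega
  · intro a b hab
    by_cases hb : b ∈ (q a).support
    · left
      have hne : R a ≠ a := by
        intro h
        have hnil : ∀ x (r : T.Walk x a), x = a → r.IsPath → b ∉ r.support := by
          rintro x r rfl hr
          rw [Walk.eq_nil_iff_nil.mpr (Walk.isPath_iff_nil.mp hr)]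
          simpa using hab.ne'
        exact hnil _ _ h (hq a) hb
      simp only [if_neg hne]
      rw [hT.eq_penultimate_of_adj_end (hq a) hab hb]
    · right
      have hp := (hq a).concat hb hab
      have hne : R b ≠ b := by
        intro h
        rw [← hRadj _ _ hab] at h
        exact hb (by rw [← h]; exact Walk.start_mem_support _)
      simp only [if_neg hne]
      rw [← hpen b _ _ (hRadj _ _ hab) hp, Walk.penultimate_concat]

section Deps

variable {V : Type u} {dep : V → Option V}

theorem deps_eq_empty {b : V} (h : dep b = none) : deps dep b = ∅ := by
  ext a
  simp only [deps, Set.mem_ofPred_eq, Set.mem_empty_iff_false, iff_false]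
  intro ha
  obtain ⟨c, hc, -⟩ := Relation.TransGen.head'_iff.mp ha
  rw [h] at hc
  exact absurd hc (by simp)

theorem deps_eq_insert {b c : V} (h : dep b = some c) : deps dep b = insert c (deps dep c) := by
  ext a
  simp only [deps, Set.mem_ofPred_eq, Set.mem_insert_iff]
  constructor
  · intro ha
    obtain ⟨c', hc', hca⟩ := Relation.TransGen.head'_iff.mp ha
    obtain rfl : c = c' := by rwa [h, Option.some_inj] at hc'
    rcases Relation.reflTransGen_iff_eq_or_transGen.mp hca with h | h
    exacts [Or.inl h, Or.inr h]
  · rintro (rfl | ha)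
    exacts [.single h, .head h ha]

theorem deps_congr {a b : V} (h : dep a = dep b) : deps dep a = deps dep b := by
  cases hb : dep b with
  | none => rw [deps_eq_empty hb, deps_eq_empty (h.trans hb)]
  | some c => rw [deps_eq_insert hb, deps_eq_insert (h.trans hb)]

end Deps

section DepFunction

variable {p : ℕ} {F : RootedGraph.{u} p} {dep : F.V → Option F.V}

/-- The graph of the edges between nodes with the same dependency. -/
def siblingGraph (F : RootedGraph.{u} p) (dep : F.V → Option F.V) : SimpleGraph F.V where
  Adj a b := F.graph.Adj a b ∧ dep a = dep b
  symm := ⟨fun _ _ h => ⟨h.1.symm, h.2.symm⟩⟩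
  loopless := ⟨fun _ h => h.1.ne rfl⟩

theorem siblingGraph_le : siblingGraph F dep ≤ F.graph := fun _ _ h => h.1

theorem IsDepFunction.isAcyclic_siblingGraph (h : IsDepFunction F dep) :
    (siblingGraph F dep).IsAcyclic := by
  intro a w hw
  have hsupp : ∀ {a b} (w : (siblingGraph F dep).Walk a b), ∀ x ∈ w.support, dep x = dep a := by
    intro a b w
    induction w with
    | nil => simp
    | cons hab w ih =>
      intro x hx
      rcases List.mem_cons.mp hx with rfl | hx
      exacts [rfl, (ih x hx).trans hab.2.symm]
  have hw' : (w.mapLe siblingGraph_le).IsCycle := hw.mapLe siblingGraph_le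
  have hmem : ∀ x ∈ (w.mapLe siblingGraph_le).support, x ∈ {x | dep x = dep a} := by
    intro x hx
    exact hsupp w x (by simpa using hx)
  refine h.acyclic (dep a) ((w.mapLe siblingGraph_le).induce _ hmem) ?_
  refine SimpleGraph.Walk.IsCycle.of_map (f := (SimpleGraph.Embedding.induce _).toHom) ?_
  rw [SimpleGraph.Walk.map_induce]
  exact hw'

/-- From every node, iterating `dep` ends at a node without dependency, which is connected with the
root through such nodes: this property is passed on along the edges. -/
theorem IsDepFunction.exists_top (h : IsDepFunction F dep) (a : F.V) :
    ∃ t, dep t = none ∧ Relation.ReflTransGen (fun x y => dep x = some y) a t ∧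
      (siblingGraph F dep).Reachable F.root t := by
  have huniq : Relator.RightUnique fun x y : F.V => dep x = some y := fun x y z hy hz =>
    Option.some_inj.mp (hy.symm.trans hz)
  have step : ∀ a b, F.graph.Adj a b →
      (∃ t, dep t = none ∧ Relation.ReflTransGen (fun x y => dep x = some y) a t ∧
        (siblingGraph F dep).Reachable F.root t) →
      ∃ t, dep t = none ∧ Relation.ReflTransGen (fun x y => dep x = some y) b t ∧
        (siblingGraph F dep).Reachable F.root t := by
    rintro a b hab ⟨t, ht, hat, hut⟩
    rcases h.edge a b hab with hdep | hdep | hdep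
    · rcases Relation.ReflTransGen.cases_head hat with rfl | ⟨c, hc, hct⟩
      · have hadj : (siblingGraph F dep).Adj a b := ⟨hab, hdep⟩
        exact ⟨b, hdep ▸ ht, .refl, hut.trans hadj.reachable⟩
      · exact ⟨t, ht, .head (hdep ▸ hc) hct, hut⟩
    · exact ⟨t, ht, hdep.to_reflTransGen.trans hat, hut⟩
    · rcases Relation.ReflTransGen.total_of_right_unique huniq hat hdep.to_reflTransGen with h' | h'
      · rcases Relation.ReflTransGen.cases_head h' with rfl | ⟨c, hc, -⟩
        · exact ⟨t, ht, .refl, hut⟩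
        · simp [ht] at hc
      · exact ⟨t, ht, h', hut⟩
  induction (SimpleGraph.reachable_iff_reflTransGen _ _).mp (F.reachable a) with
  | refl => exact ⟨F.root, h.root, .refl, .refl _⟩
  | tail _ hab ih => exact step _ _ hab ih

theorem IsDepFunction.notMem_deps_self (h : IsDepFunction F dep) (a : F.V) : a ∉ deps dep a := by
  intro ha
  obtain ⟨t, ht, hat, -⟩ := h.exists_top a
  have hcycle : t ∈ deps dep t := by
    clear ht
    induction hat with
    | refl => exact ha
    | @tail x y _ hxy ih =>
      rw [deps_eq_insert hxy] at ih
      rcases ih with rfl | hy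
      · exact Relation.TransGen.single hxy
      · exact Relation.TransGen.tail hy hxy
  rw [deps_eq_empty ht] at hcycle
  exact hcycle

theorem IsDepFunction.ncard_deps_of_eq_some (h : IsDepFunction F dep) {b c : F.V}
    (hbc : dep b = some c) : (deps dep b).ncard = (deps dep c).ncard + 1 := by
  rw [deps_eq_insert hbc, Set.ncard_insert_of_notMem (h.notMem_deps_self c)]

theorem IsDepFunction.ncard_deps_lt (h : IsDepFunction F dep) {b c : F.V} (hc : c ∈ deps dep b) :
    (deps dep c).ncard < (deps dep b).ncard :=
  Set.ncard_lt_ncard ⟨fun _ hx => Relation.TransGen.trans hc hx,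
    fun hle => h.notMem_deps_self c (hle hc)⟩

/-- A tree on the nodes of `F` along which homomorphisms are counted. Every node `b` other than the
root has a parent, which is either a neighbour of `b` with the same dependency, or the dependency of
`b`; in the second case, there is a walk of length `len b + 1` between them. -/
structure EliminationTree (F : RootedGraph.{u} p) (dep : F.V → Option F.V) where
  /-- The parent; its value at the root is irrelevant. -/
  par : F.V → F.V
  len : F.V → ℕ
  /-- The parent and the dependencies of a node precede it in this order. -/
  ord : F.V → ℕ
  ord_par : ∀ b, b ≠ F.root → ord (par b) < ord b
  ord_deps : ∀ b, ∀ c ∈ deps dep b, ord c < ord b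
  link : ∀ b, b ≠ F.root →
    (dep b = dep (par b) ∧ F.graph.Adj (par b) b) ∨
    (dep b = some (par b) ∧ ∃ w : F.graph.Walk (par b) b, w.length = len b + 1)
  edge : ∀ a b, F.graph.Adj a b →
    (b ≠ F.root ∧ par b = a ∧ dep b = dep a) ∨ (a ≠ F.root ∧ par a = b ∧ dep a = dep b) ∨
    a ∈ deps dep b ∨ b ∈ deps dep a

theorem IsDepFunction.nonempty_eliminationTree (h : IsDepFunction F dep) :
    Nonempty (EliminationTree F dep) := by
  classical
  obtain ⟨par, t, hroot, hpar, hadj⟩ := h.isAcyclic_siblingGraph.exists_orientation F.root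
  let par' : F.V → F.V := fun b => ((par b).orElse fun _ => dep b).getD F.root
  have hcase : ∀ b, b ≠ F.root →
      (par b = some (par' b)) ∨ (dep b = some (par' b)) := by
    intro b hb
    cases hp : par b with
    | some a => exact Or.inl (by simp [par', hp])
    | none =>
      cases hd : dep b with
      | some c => exact Or.inr (by simp [par', hp, hd])
      | none =>
        obtain ⟨t, -, hbt, hut⟩ := h.exists_top b
        rcases Relation.ReflTransGen.cases_head hbt with rfl | ⟨c, hc, -⟩
        · exact absurd (hroot b hut hp) hb
        · simp [hd] at hc
  have hwalk : ∀ b, ∃ l, ∀ c, dep b = some c → ∃ w : F.graph.Walk c b, w.length = l + 1 := by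
    intro b
    cases hd : dep b with
    | none => exact ⟨0, by simp⟩
    | some c =>
      obtain ⟨w⟩ := (F.reachable c).symm.trans (F.reachable b)
      have hw : w.length ≠ 0 := by
        intro h0
        obtain rfl := SimpleGraph.Walk.eq_of_length_eq_zero h0
        exact h.notMem_deps_self _ (Relation.TransGen.single hd)
      refine ⟨w.length - 1, fun c' hc' => ?_⟩
      obtain rfl := Option.some_inj.mp hc'
      exact ⟨w, by omega⟩
  choose len hlen using hwalk
  -- Lexicographic order by the number of dependencies and the distance to the root of the component.
  let M := Finset.univ.sup t + 1
  have hM : ∀ b, t b < M := fun b => Nat.lt_succ_of_le (Finset.le_sup (Finset.mem_univ b))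
  have hlt : ∀ b, ∀ c ∈ deps dep b,
      (deps dep c).ncard * M + t c < (deps dep b).ncard * M + t b := by
    intro b c hc
    have h₁ := Nat.mul_le_mul_right M (Nat.succ_le_of_lt (h.ncard_deps_lt hc))
    rw [Nat.succ_mul] at h₁
    have := hM c
    omega
  refine ⟨⟨par', len, fun b => (deps dep b).ncard * M + t b, ?_, hlt, ?_, ?_⟩⟩
  · intro b hb
    rcases hcase b hb with h' | h'
    · obtain ⟨-, hadj', ht⟩ := hpar b _ h'
      rw [deps_congr hadj'.2]
      omega
    · exact hlt b _ (Relation.TransGen.single h')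
  · intro b hb
    rcases hcase b hb with h' | h'
    · obtain ⟨-, hadj', -⟩ := hpar b _ h'
      exact Or.inl ⟨hadj'.2, hadj'.1.symm⟩
    · exact Or.inr ⟨h', hlen b _ h'⟩
  · intro a b hab
    rcases h.edge a b hab with hdep | hdep | hdep
    · rcases hadj a b ⟨hab, hdep⟩ with h' | h'
      · exact Or.inr (Or.inl ⟨(hpar a b h').1, by simp [par', h'], hdep⟩)
      · exact Or.inl ⟨(hpar b a h').1, by simp [par', h'], hdep.symm⟩
    · exact Or.inr (Or.inr (Or.inl hdep))
    · exact Or.inr (Or.inr (Or.inr hdep))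

end DepFunction

/-! ### Expressible node functions -/

namespace NodeFn

variable {p d D : ℕ}

theorem Expressible.const (c : ℝ) : Expressible d D (fun _ _ _ => c : NodeFn.{v} p D) := by
  cases d <;> exact Generated.const c

theorem Expressible.mul {f g : NodeFn.{v} p D} (hf : Expressible d D f)
    (hg : Expressible d D g) : Expressible d D fun G emb x => f G emb x * g G emb x := by
  cases d <;> exact Generated.mul hf hg

theorem Expressible.nbrSum {f : NodeFn.{v} p D} (hf : Expressible d D f) :
    Expressible d D f.nbrSum := by
  cases d <;> exact Generated.nbrSum hf

theorem Expressible.invNbrSum {f : NodeFn.{v} p D} (hf : Expressible d D f) :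
    Expressible d D fun G emb x => (f.nbrSum G emb x)⁻¹ := by
  cases d <;> exact Generated.invNbrSum hf

theorem Expressible.ego {f : NodeFn.{v} p (D + 1)} (hf : Expressible d (D + 1) f) :
    Expressible (d + 1) D f.ego :=
  Generated.of (Or.inr ⟨f, hf, rfl⟩)

theorem Expressible.coord (n : ℕ) : Expressible d D (NodeFn.coord.{v} p D n) := by
  by_cases h : n < D
  · have : NodeFn.coord.{v} p D n = fun _ emb x => emb x ⟨n, h⟩ := by
      funext G emb x
      exact dif_pos h
    rw [this]
    cases d with
    | zero => exact Generated.of ⟨⟨n, h⟩, rfl⟩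
    | succ d => exact Generated.of (Or.inl ⟨⟨n, h⟩, rfl⟩)
  · have : NodeFn.coord.{v} p D n = fun _ _ _ => 0 := by
      funext G emb x
      exact dif_neg h
    rw [this]
    exact .const 0

theorem Expressible.prod {ι : Type*} (s : Finset ι) {f : ι → NodeFn.{v} p D}
    (hf : ∀ i ∈ s, Expressible d D (f i)) :
    Expressible d D fun G emb x => ∏ i ∈ s, f i G emb x := by
  classical
  induction s using Finset.induction with
  | empty => simpa using Expressible.const 1
  | insert i s hi ih =>
    simp only [Finset.prod_insert hi]
    exact .mul (hf i (Finset.mem_insert_self i s))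
      (ih fun j hj => hf j (Finset.mem_insert_of_mem hj))

theorem Expressible.iterate_nbrSum {f : NodeFn.{v} p D} (hf : Expressible d D f) (n : ℕ) :
    Expressible d D (NodeFn.nbrSum^[n] f) := by
  induction n with
  | zero => exact hf
  | succ n ih =>
    rw [Function.iterate_succ_apply']
    exact ih.nbrSum

theorem coord_markNode_of_lt {n : ℕ} (h : n < D) (G : LGraph.{v} p) (emb : G.V → Fin D → ℝ)
    (x y : G.V) :
    coord p (D + 1) n G (markNode G emb x) y = coord p D n G emb y := by
  simp only [coord, dif_pos h, dif_pos (Nat.lt_succ_of_lt h), markNode]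
  exact Fin.append_left (emb y) _ ⟨n, h⟩

open Classical in
theorem coord_markNode_self (G : LGraph.{v} p) (emb : G.V → Fin D → ℝ) (x y : G.V) :
    coord p (D + 1) D G (markNode G emb x) y = if y = x then 1 else 0 := by
  simp only [coord, dif_pos (Nat.lt_succ_self D), markNode]
  exact Fin.append_right (emb y) (fun _ : Fin 1 => if y = x then (1 : ℝ) else 0) 0

open Classical in
theorem iterate_nbrSum_eq_mulVec (f : NodeFn.{v} p D) (n : ℕ) (G : LGraph.{v} p)
    (emb : G.V → Fin D → ℝ) :
    nbrSum^[n] f G emb = ((G.graph.adjMatrix ℝ) ^ n).mulVec (f G emb) := by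
  induction n with
  | zero => simp
  | succ n ih =>
    rw [Function.iterate_succ_apply', pow_succ', ← Matrix.mulVec_mulVec, ← ih]
    funext x
    rw [SimpleGraph.adjMatrix_mulVec_apply, nbrSum]
    refine Finset.sum_congr ?_ fun _ _ => rfl
    ext y
    simp

end NodeFn

open Classical in
theorem SimpleGraph.adjMatrix_pow_mul_inv {V : Type*} [Fintype V] (G : SimpleGraph V) (n : ℕ)
    (x y : V) :
    (G.adjMatrix ℝ ^ n) x y * ((G.adjMatrix ℝ ^ n) y x)⁻¹ =
      if ∃ w : G.Walk x y, w.length = n then 1 else 0 := by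
  have hsymm : (G.adjMatrix ℝ ^ n) y x = (G.adjMatrix ℝ ^ n) x y := by
    have : (G.adjMatrix ℝ ^ n).transpose = G.adjMatrix ℝ ^ n := by
      rw [Matrix.transpose_pow, SimpleGraph.transpose_adjMatrix]
    exact congrFun (congrFun this x) y
  rw [hsymm, SimpleGraph.adjMatrix_pow_apply_eq_card_walk]
  split_ifs with h
  · obtain ⟨w, hw⟩ := h
    have : (0 : ℝ) < Fintype.card {w : G.Walk x y | w.length = n} :=
      Nat.cast_pos.mpr (Fintype.card_pos_iff.mpr ⟨⟨w, hw⟩⟩)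
    exact mul_inv_cancel₀ this.ne'
  · have : Fintype.card {w : G.Walk x y | w.length = n} = 0 :=
      Fintype.card_eq_zero_iff.mpr ⟨fun w => h ⟨w.1, w.2⟩⟩
    simp [this]

/-! ### Counting homomorphisms by elimination -/

section Elimination

variable {p : ℕ} {F : RootedGraph.{u} p} {dep : F.V → Option F.V}

open Classical in
/-- The embedding marks the images under `h` of the dependencies of `b`; the mark of `h c` is the
coordinate `p + |deps c|`. The first `p` coordinates are the labels. -/
structure Encodes (dep : F.V → Option F.V) {D : ℕ} (b : F.V) (G : LGraph.{v} p)
    (emb : G.V → Fin D → ℝ) (h : F.V → G.V) : Prop where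
  label : ∀ (i : Fin p) y, NodeFn.coord p D i G emb y = labelEmb G y i
  mark : ∀ c ∈ deps dep b, ∀ y,
    NodeFn.coord p D (p + (deps dep c).ncard) G emb y = if y = h c then 1 else 0

/-- A weight `Ψ` of maps `h : F.V → G.V` is local at `b` if it only depends on the images of `b` and
of the dependencies of `b`, and, when the images of the dependencies are marked, it is an expressible
function of the image of `b`, with as many nested egos as there are marks missing from `d`. -/
structure IsLocal (dep : F.V → Option F.V) (d : ℕ) (b : F.V)
    (Ψ : ∀ G : LGraph.{v} p, (F.V → G.V) → ℝ) : Prop where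
  congr : ∀ G (h h' : F.V → G.V), (∀ c ∈ deps dep b, h c = h' c) → h b = h' b → Ψ G h = Ψ G h'
  expressible : ∀ s D, D = p + (deps dep b).ncard → s + (deps dep b).ncard = d →
    ∃ f : NodeFn.{v} p D, NodeFn.Expressible s D f ∧ ∀ G emb h, Encodes dep b G emb h →
      f G emb (h b) = Ψ G h

theorem IsLocal.mul {d : ℕ} {b : F.V} {Ψ Ψ' : ∀ G : LGraph.{v} p, (F.V → G.V) → ℝ}
    (hΨ : IsLocal dep d b Ψ) (hΨ' : IsLocal dep d b Ψ') :
    IsLocal dep d b fun G h => Ψ G h * Ψ' G h := by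
  refine ⟨fun G h h' h₁ h₂ => ?_, fun s D hD hs => ?_⟩
  · rw [hΨ.congr G h h' h₁ h₂, hΨ'.congr G h h' h₁ h₂]
  · obtain ⟨f, hf, hfΨ⟩ := hΨ.expressible s D hD hs
    obtain ⟨f', hf', hfΨ'⟩ := hΨ'.expressible s D hD hs
    exact ⟨_, hf.mul hf', fun G emb h he => by rw [hfΨ G emb h he, hfΨ' G emb h he]⟩

/-- The conditions on a homomorphism at `b`: those on the label of `b` and those on the edges from
`b` to its dependencies. -/
def LocalCondition (F : RootedGraph.{u} p) (dep : F.V → Option F.V) (b : F.V) (G : LGraph.{v} p)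
    (h : F.V → G.V) : Prop :=
  F.lab b ⊆ G.lab (h b) ∧ ∀ c ∈ deps dep b, F.graph.Adj b c → G.graph.Adj (h b) (h c)

open Classical in
theorem isLocal_localCondition (d : ℕ) (b : F.V) :
    IsLocal.{u, v} dep d b fun G h => if LocalCondition F dep b G h then 1 else 0 := by
  refine ⟨fun G h h' h₁ h₂ => ?_, fun s D _ _ => ?_⟩
  · have : LocalCondition F dep b G h ↔ LocalCondition F dep b G h' := by
      unfold LocalCondition
      rw [h₂]
      exact and_congr_right fun _ => forall₂_congr fun c hc => by rw [h₁ c hc]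
    simp only [this]
  · refine ⟨_, (NodeFn.Expressible.prod (F.lab b) fun i _ => .coord i.val).mul
      (NodeFn.Expressible.prod (Finset.univ.filter fun c => c ∈ deps dep b ∧ F.graph.Adj b c)
        fun c _ => NodeFn.Expressible.nbrSum (.coord (p + (deps dep c).ncard))), ?_⟩
    intro G emb h he
    have h₁ : ∏ i ∈ F.lab b, NodeFn.coord p D i G emb (h b) =
        if F.lab b ⊆ G.lab (h b) then 1 else 0 := by
      simp only [he.label, labelEmb, Finset.prod_boole]
      rfl
    have h₂ : ∏ c with c ∈ deps dep b ∧ F.graph.Adj b c,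
        (NodeFn.coord p D (p + (deps dep c).ncard)).nbrSum G emb (h b) =
        if ∀ c ∈ deps dep b, F.graph.Adj b c → G.graph.Adj (h b) (h c) then 1 else 0 := by
      have : ∀ c ∈ (Finset.univ.filter fun c => c ∈ deps dep b ∧ F.graph.Adj b c),
          (NodeFn.coord p D (p + (deps dep c).ncard)).nbrSum G emb (h b) =
            if G.graph.Adj (h b) (h c) then 1 else 0 := by
        intro c hc
        simp only [NodeFn.nbrSum, he.mark c (Finset.mem_filter.mp hc).2.1, Finset.sum_ite_eq',
          Finset.mem_filter, Finset.mem_univ, true_and]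
      rw [Finset.prod_congr rfl this, Finset.prod_boole]
      simp only [Finset.mem_filter, Finset.mem_univ, true_and, and_imp]
    rw [h₁, h₂, LocalCondition]
    split_ifs <;> simp_all

namespace EliminationTree

variable (T : EliminationTree F dep)

/-- The condition on the images `x` and `y` of the parent of `b` and of `b`. If the parent is the
dependency of `b`, every homomorphism satisfies it. -/
def LinkCondition (b : F.V) (G : LGraph.{v} p) (x y : G.V) : Prop :=
  (dep b = dep (T.par b) ∧ G.graph.Adj x y) ∨
  (dep b = some (T.par b) ∧ ∃ w : G.graph.Walk x y, w.length = T.len b + 1)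

open Classical in
/-- Summing over the image of `b` turns a weight that is local at `b` into one that is local at the
parent of `b`. If the parent is the dependency of `b`, its image `x` can be marked. The sum over the
nodes `y` at the end of a walk of length `n` from `x` then is a sum over all these walks, in which
the term of `y` is divided by the number of walks between `x` and `y`. -/
theorem isLocal_message (hdep : IsDepFunction F dep) {d : ℕ}
    (hd : ∀ b, (deps dep b).ncard ≤ d) {b : F.V} (hb : b ≠ F.root)
    {Ψ : ∀ G : LGraph.{v} p, (F.V → G.V) → ℝ} (hΨ : IsLocal dep d b Ψ) :
    IsLocal dep d (T.par b) fun G h =>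
      ∑ y, (if T.LinkCondition b G (h (T.par b)) y then 1 else 0) * Ψ G (Function.update h b y) := by
  have hself := hdep.notMem_deps_self b
  have hupd : ∀ {G : LGraph.{v} p} (h : F.V → G.V) y, ∀ c ∈ deps dep b,
      Function.update h b y c = h c := fun h y c hc =>
    Function.update_of_ne (ne_of_mem_of_not_mem hc hself) _ _
  have hsub : ∀ c ∈ deps dep b, c = T.par b ∨ c ∈ deps dep (T.par b) := by
    intro c hc
    rcases T.link b hb with ⟨h, -⟩ | ⟨h, -⟩
    · exact Or.inr (deps_congr h ▸ hc)
    · rwa [deps_eq_insert h] at hc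
  refine ⟨fun G h h' h₁ h₂ => ?_, fun s D hD hs => ?_⟩
  · rw [h₂]
    refine Finset.sum_congr rfl fun y _ => ?_
    rw [hΨ.congr G (Function.update h b y) (Function.update h' b y) (fun c hc => ?_) (by simp)]
    rw [hupd h y c hc, hupd h' y c hc]
    rcases hsub c hc with rfl | hc'
    exacts [h₂, h₁ c hc']
  · rcases T.link b hb with ⟨hpar, -⟩ | ⟨hpar, -⟩
    · have hdeps := deps_congr hpar
      rw [← hdeps] at hD hs
      obtain ⟨f, hf, hfΨ⟩ := hΨ.expressible s D hD hs
      have hnot : dep b ≠ some (T.par b) := fun h =>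
        hdep.notMem_deps_self (T.par b) (Relation.TransGen.single (hpar ▸ h))
      refine ⟨_, hf.nbrSum, fun G emb h he => ?_⟩
      rw [NodeFn.nbrSum, Finset.sum_filter]
      refine Finset.sum_congr rfl fun y _ => ?_
      have hy : f G emb y = Ψ G (Function.update h b y) := by
        rw [← hfΨ G emb (Function.update h b y) ⟨he.label, fun c hc z => ?_⟩,
          Function.update_self]
        rw [hupd h y c hc]
        exact he.mark c (hdeps ▸ hc) z
      simp [LinkCondition, hpar, hpar ▸ hnot, hy]
    · have hcard := hdep.ncard_deps_of_eq_some hpar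
      have hle := hd b
      obtain ⟨s, rfl⟩ : ∃ s', s = s' + 1 := ⟨s - 1, by omega⟩
      obtain ⟨f, hf, hfΨ⟩ := hΨ.expressible s (D + 1) (by omega) (by omega)
      have hnot : dep b ≠ dep (T.par b) := fun h =>
        hdep.notMem_deps_self (T.par b) (Relation.TransGen.single (h ▸ hpar))
      have hmark : NodeFn.Expressible s (D + 1) (NodeFn.coord.{v} p (D + 1) D) := .coord D
      refine ⟨_, ((hf.mul (hmark.iterate_nbrSum (T.len b)).invNbrSum).iterate_nbrSum
        (T.len b + 1)).ego, fun G emb h he => ?_⟩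
      set x := h (T.par b) with hx
      have hy : ∀ y, f G (markNode G emb x) y = Ψ G (Function.update h b y) := by
        intro y
        rw [← hfΨ G (markNode G emb x) (Function.update h b y) ⟨fun i z => ?_, fun c hc z => ?_⟩,
          Function.update_self]
        · rw [NodeFn.coord_markNode_of_lt (by omega), he.label]
        · rw [hupd h y c hc]
          rcases hsub c hc with rfl | hc'
          · rw [← hD, NodeFn.coord_markNode_self]
          · rw [NodeFn.coord_markNode_of_lt (by have := hdep.ncard_deps_lt hc'; omega),
              he.mark c hc']
      have hq : ∀ y, (NodeFn.nbrSum^[T.len b] (NodeFn.coord p (D + 1) D)).nbrSum G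
          (markNode G emb x) y = (G.graph.adjMatrix ℝ ^ (T.len b + 1)) y x := by
        intro y
        rw [← Function.iterate_succ_apply' (f := NodeFn.nbrSum),
          NodeFn.iterate_nbrSum_eq_mulVec]
        simp [Matrix.mulVec, dotProduct, NodeFn.coord_markNode_self]
      rw [NodeFn.ego, NodeFn.iterate_nbrSum_eq_mulVec]
      simp only [Matrix.mulVec, dotProduct, hy, hq]
      refine Finset.sum_congr rfl fun y _ => ?_
      rw [mul_comm (Ψ G _), ← mul_assoc, SimpleGraph.adjMatrix_pow_mul_inv]
      simp [LinkCondition, hpar, hpar ▸ hnot]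

/-- The maps from `F.V` to `G.V` that take the value `x` at the root and outside of `R`. -/
noncomputable def assignments (F : RootedGraph.{u} p) (R : Finset F.V) (G : LGraph.{v} p)
    (x : G.V) : Finset (F.V → G.V) := by
  classical
  exact Finset.univ.filter fun h => ∀ b, b ∉ R ∨ b = F.root → h b = x

theorem mem_assignments {R : Finset F.V} {G : LGraph.{v} p} {x : G.V} {h : F.V → G.V} :
    h ∈ assignments F R G x ↔ ∀ b, b ∉ R ∨ b = F.root → h b = x := by
  simp [assignments]

open Classical in
theorem sum_assignments {R : Finset F.V} {b : F.V} (hbR : b ∈ R) (hb : b ≠ F.root)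
    (G : LGraph.{v} p) (x : G.V) (φ : (F.V → G.V) → ℝ) :
    ∑ h ∈ assignments F R G x, φ h =
      ∑ h ∈ assignments F (R.erase b) G x, ∑ y, φ (Function.update h b y) := by
  rw [← Finset.sum_product']
  refine Finset.sum_nbij' (fun h => (Function.update h b x, h b))
    (fun q => Function.update q.1 b q.2) ?_ ?_ ?_ ?_ ?_
  · intro h hh
    rw [mem_assignments] at hh
    rw [Finset.mem_product, mem_assignments]
    refine ⟨fun c hc => ?_, Finset.mem_univ _⟩
    by_cases hcb : c = b
    · rw [hcb]; simp
    · simp only [Function.update_of_ne hcb]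
      exact hh c (hc.imp_left fun h' h'' => h' (Finset.mem_erase.mpr ⟨hcb, h''⟩))
  · rintro ⟨h, y⟩ hq
    rw [Finset.mem_product, mem_assignments] at hq
    rw [mem_assignments]
    intro c hc
    have hcb : c ≠ b := by
      rintro rfl
      rcases hc with hc | hc
      exacts [hc hbR, hb hc]
    simp only [Function.update_of_ne hcb]
    exact hq.1 c (hc.imp_left fun h' h'' => h' (Finset.mem_of_mem_erase h''))
  · intro h _
    simp
  · rintro ⟨h, y⟩ hq
    rw [Finset.mem_product, mem_assignments] at hq
    have := hq.1 b (Or.inl (Finset.notMem_erase b R))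
    simp [← this]
  · intro h _
    simp

open Classical in
/-- Sums of products of local weights, along the tree, are local at the root: the nodes are
eliminated one after the other, each after its children. -/
theorem exists_isLocal_sum (hdep : IsDepFunction F dep) {d : ℕ}
    (hd : ∀ b, (deps dep b).ncard ≤ d) (R : Finset F.V) (hroot : F.root ∈ R)
    (hpar : ∀ b ∈ R, b ≠ F.root → T.par b ∈ R)
    (Ψ : F.V → ∀ G : LGraph.{v} p, (F.V → G.V) → ℝ) (hΨ : ∀ b ∈ R, IsLocal dep d b (Ψ b)) :
    ∃ Φ : ∀ G : LGraph.{v} p, (F.V → G.V) → ℝ, IsLocal dep d F.root Φ ∧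
      ∀ G x, ∑ h ∈ assignments F R G x, (∏ b ∈ R, Ψ b G h) *
        ∏ b ∈ R.erase F.root, (if T.LinkCondition b G (h (T.par b)) (h b) then 1 else 0) =
        Φ G fun _ => x := by
  induction hn : R.card generalizing R Ψ with
  | zero => simp [Finset.card_eq_zero.mp hn] at hroot
  | succ n ih =>
    by_cases hne : (R.erase F.root).Nonempty
    · -- Eliminate the last node `b`, multiplying the weight of its parent by its message.
      obtain ⟨b, hbR', hmax⟩ := Finset.exists_max_image _ T.ord hne
      obtain ⟨hb, hbR⟩ := Finset.mem_erase.mp hbR'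
      have hab : T.par b ≠ b := fun h => by have := T.ord_par b hb; rw [h] at this; omega
      -- As `b` comes last, it is neither a dependency nor the parent of another node of `R`.
      have hlast_deps : ∀ c ∈ R.erase b, b ∉ deps dep c := by
        intro c hc hbc
        by_cases hcr : c = F.root
        · rw [hcr, deps_eq_empty hdep.root] at hbc
          exact hbc
        · exact (T.ord_deps c b hbc).not_ge
            (hmax c (Finset.mem_erase.mpr ⟨hcr, Finset.mem_of_mem_erase hc⟩))
      have hlast_par : ∀ c ∈ R.erase b, c ≠ F.root → T.par c ≠ b := by
        intro c hc hcr h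
        have := T.ord_par c hcr
        rw [h] at this
        exact this.not_ge (hmax c (Finset.mem_erase.mpr ⟨hcr, Finset.mem_of_mem_erase hc⟩))
      let Ψ' : F.V → ∀ G : LGraph.{v} p, (F.V → G.V) → ℝ := fun c G h =>
        Ψ c G h * if c = T.par b then ∑ y, (if T.LinkCondition b G (h (T.par b)) y then 1 else 0) *
          Ψ b G (Function.update h b y) else 1
      have haR : T.par b ∈ R.erase b := Finset.mem_erase.mpr ⟨hab, hpar b hbR hb⟩
      obtain ⟨Φ, hΦ, hsum⟩ := ih (R.erase b) (Finset.mem_erase.mpr ⟨hb.symm, hroot⟩)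
        (fun c hc hcr => Finset.mem_erase.mpr
          ⟨hlast_par c hc hcr, hpar c (Finset.mem_of_mem_erase hc) hcr⟩) Ψ'
        (fun c hc => by
          have hc' := hΨ c (Finset.mem_of_mem_erase hc)
          by_cases hca : c = T.par b
          · simp only [Ψ', if_pos hca]
            subst hca
            exact hc'.mul (T.isLocal_message hdep hd hb (hΨ b hbR))
          · simpa only [Ψ', if_neg hca, mul_one] using hc')
        (by rw [Finset.card_erase_of_mem hbR, hn]; rfl)
      refine ⟨Φ, hΦ, fun G x => ?_⟩
      rw [← hsum, sum_assignments hbR hb]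
      refine Finset.sum_congr rfl fun h _ => ?_
      have h₁ : ∏ c ∈ R.erase b, Ψ' c G h = (∏ c ∈ R.erase b, Ψ c G h) *
          ∑ y, (if T.LinkCondition b G (h (T.par b)) y then 1 else 0) *
            Ψ b G (Function.update h b y) := by
        simp only [Ψ', Finset.prod_mul_distrib, Finset.prod_ite_eq', if_pos haR]
      rw [h₁, mul_right_comm, Finset.mul_sum]
      refine Finset.sum_congr rfl fun y _ => ?_
      have h₂ : ∏ c ∈ R.erase b, Ψ c G (Function.update h b y) = ∏ c ∈ R.erase b, Ψ c G h := by
        refine Finset.prod_congr rfl fun c hc => ?_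
        refine (hΨ c (Finset.mem_of_mem_erase hc)).congr G _ _ (fun e he => ?_) ?_
        · exact Function.update_of_ne (ne_of_mem_of_not_mem he (hlast_deps c hc)) _ _
        · exact Function.update_of_ne (Finset.ne_of_mem_erase hc) _ _
      have h₃ : ∏ c ∈ (R.erase F.root).erase b, (if T.LinkCondition c G
            (Function.update h b y (T.par c)) (Function.update h b y c) then (1 : ℝ) else 0) =
          ∏ c ∈ (R.erase b).erase F.root,
            if T.LinkCondition c G (h (T.par c)) (h c) then (1 : ℝ) else 0 := by
        rw [Finset.erase_right_comm]
        refine Finset.prod_congr rfl fun c hc => ?_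
        obtain ⟨hcr, hc⟩ := Finset.mem_erase.mp hc
        rw [Function.update_of_ne (Finset.ne_of_mem_erase hc),
          Function.update_of_ne (hlast_par c hc hcr)]
      rw [← Finset.mul_prod_erase R _ hbR, ← Finset.mul_prod_erase (R.erase F.root) _ hbR', h₂, h₃,
        Function.update_of_ne hab, Function.update_self]
      ring
    · have hR : R = {F.root} := by
        refine Finset.eq_singleton_iff_unique_mem.mpr ⟨hroot, fun b hb => ?_⟩
        by_contra h
        exact hne ⟨b, Finset.mem_erase.mpr ⟨h, hb⟩⟩
      subst hR
      refine ⟨Ψ F.root, hΨ _ hroot, fun G x => ?_⟩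
      have : assignments F {F.root} G x = {fun _ => x} := by
        ext h
        rw [mem_assignments, Finset.mem_singleton, funext_iff]
        refine forall_congr' fun b => ?_
        simp [em']
      simp [this]

/-- Every edge of `F` is covered by a condition at one of its ends or by a condition on a tree edge. -/
theorem isPointedHom_iff (hdep : IsDepFunction F dep) (G : LGraph.{v} p) (x : G.V) (h : F.V → G.V) :
    IsPointedHom F G x h ↔ h F.root = x ∧ (∀ b, LocalCondition F dep b G h) ∧
      ∀ b, b ≠ F.root → T.LinkCondition b G (h (T.par b)) (h b) := by
  constructor
  · intro hh
    refine ⟨hh.map_root, fun b => ⟨hh.map_lab b, fun c _ hbc => hh.map_adj b c hbc⟩,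
      fun b hb => ?_⟩
    rcases T.link b hb with ⟨h₁, h₂⟩ | ⟨h₁, w, hw⟩
    · exact Or.inl ⟨h₁, hh.map_adj _ _ h₂⟩
    · let φ : F.graph →g G.graph := ⟨h, fun {a b} hab => hh.map_adj a b hab⟩
      exact Or.inr ⟨h₁, w.map φ, by rw [SimpleGraph.Walk.length_map, hw]⟩
  · rintro ⟨h₁, h₂, h₃⟩
    have hadj : ∀ a b, b ≠ F.root → T.par b = a → dep b = dep a → G.graph.Adj (h a) (h b) := by
      rintro a b hb rfl hab
      rcases h₃ b hb with ⟨-, h⟩ | ⟨h, -⟩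
      · exact h
      · exact absurd (Relation.TransGen.single (hab ▸ h)) (hdep.notMem_deps_self (T.par b))
    refine ⟨fun a b hab => ?_, fun b => (h₂ b).1, h₁⟩
    rcases T.edge a b hab with ⟨hb, hp, hd⟩ | ⟨ha, hp, hd⟩ | hc | hc
    · exact hadj a b hb hp hd
    · exact (hadj b a ha hp hd).symm
    · exact ((h₂ b).2 a hc hab.symm).symm
    · exact (h₂ a).2 b hc hab

open Classical in
/-- The number of homomorphisms, as a sum of products of local weights along the tree. -/
theorem homCount_eq_sum (hdep : IsDepFunction F dep) (G : LGraph.{v} p) (x : G.V) :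
    (homCount F G x : ℝ) = ∑ h ∈ assignments F Finset.univ G x,
      (∏ b, if LocalCondition F dep b G h then 1 else 0) *
        ∏ b ∈ Finset.univ.erase F.root,
          (if T.LinkCondition b G (h (T.par b)) (h b) then 1 else 0) := by
  rw [homCount, Nat.card_eq_fintype_card, Fintype.card_subtype, Finset.natCast_card_filter,
    assignments, Finset.sum_filter]
  refine Finset.sum_congr rfl fun h _ => ?_
  simp only [T.isPointedHom_iff hdep, Finset.prod_boole, Finset.mem_univ, not_true, false_or,
    forall_eq, Finset.mem_erase, and_true, forall_const, ite_and, mul_ite, mul_one, mul_zero]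
  split_ifs <;> simp_all

end EliminationTree

end Elimination

theorem exists_isDepFunction_ncard_le {p d : ℕ} (F : RootedGraph.{u} p) (hd : egoRank F ≤ d) :
    ∃ dep, IsDepFunction F dep ∧ ∀ b, (deps dep b).ncard ≤ d := by
  obtain ⟨dep₀, h₀⟩ := exists_isDepFunction F
  obtain ⟨dep, hdep, hrank⟩ := Nat.sInf_mem
    (s := {r | ∃ dep, IsDepFunction F dep ∧ maxNodeRank F dep = r}) ⟨_, dep₀, h₀, rfl⟩
  refine ⟨dep, hdep, fun b => le_trans ?_ (hrank.trans_le hd)⟩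
  exact Finset.le_sup (f := fun a => (deps dep a).ncard) (Finset.mem_univ b)

/-- For rooted graphs of ego-rank at most `d`, the number of homomorphisms is expressible with `d`
nested egos. -/
theorem exists_expressible_homCount {p d : ℕ} (F : RootedGraph.{u} p) (hd : egoRank F ≤ d) :
    ∃ f : NodeFn.{v} p p, NodeFn.Expressible d p f ∧
      ∀ G x, f G (labelEmb G) x = homCount F G x := by
  classical
  obtain ⟨dep, hdep, hrank⟩ := exists_isDepFunction_ncard_le F hd
  obtain ⟨T⟩ := hdep.nonempty_eliminationTree
  obtain ⟨Φ, hΦ, hsum⟩ := T.exists_isLocal_sum hdep hrank Finset.univ (Finset.mem_univ _)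
    (fun _ _ _ => Finset.mem_univ _) _ fun b _ => isLocal_localCondition d b
  have hroot := deps_eq_empty hdep.root
  obtain ⟨f, hf, hfΦ⟩ := hΦ.expressible d p (by simp [hroot]) (by simp [hroot])
  refine ⟨f, hf, fun G x => ?_⟩
  rw [T.homCount_eq_sum hdep, hsum]
  exact hfΦ G (labelEmb G) (fun _ => x) ⟨fun i y => dif_pos i.isLt, by simp [hroot]⟩

theorem labelEmb_mem_piFinset {p : ℕ} (G : LGraph.{v} p) (x : G.V) :
    labelEmb G x ∈ Fintype.piFinset fun _ : Fin p => ({0, 1} : Finset ℝ) := by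
  refine Fintype.mem_piFinset.mpr fun i => ?_
  unfold labelEmb
  split_ifs <;> simp

theorem mainTheorem3 (p k d : ℕ) (F : Fin k → RootedGraph.{u} p) (hd : ∀ i, egoRank (F i) ≤ d) :
    (∃ A : HEGNN d p (p + k),
      A.AllLayers (fun L => L.UsesReLUMul) ∧
      ∀ (G : LGraph.{v} p) (x : G.V),
        A.run G (labelEmb G) x = Fin.append (labelEmb G x) (fun i => (homCount (F i) G x : ℝ))) ∧
    (∀ N : ℕ, 0 < N →
      ∃ A : HEGNN d p (p + k),
        A.AllLayers (fun L => L.UsesSumReLU) ∧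
        ∀ G : LGraph.{v} p, (∀ w : G.V, (G.graph.neighborSet w).ncard ≤ N) → ∀ x : G.V,
          A.run G (labelEmb G) x =
            Fin.append (labelEmb G x) (fun i => (homCount (F i) G x : ℝ))) := by
  choose f hf hcount using fun i => exists_expressible_homCount.{u, v} (F i) (hd i)
  have hexpr : ∀ i, NodeFn.Expressible d p
      (Fin.append (fun i : Fin p => NodeFn.coord.{v} p p i) f i) := by
    intro i
    induction i using Fin.addCases with
    | left i => simpa using NodeFn.Expressible.coord _
    | right i => simpa using hf i
  obtain ⟨A, hA, hrun⟩ := NodeFn.exists_hegnn _ hexpr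
  have hA' : ∀ (G : LGraph.{v} p) (x : G.V), A.run G (labelEmb G) x =
      Fin.append (labelEmb G x) fun i => (homCount (F i) G x : ℝ) := by
    intro G x
    rw [hrun]
    funext i
    induction i using Fin.addCases with
    | left i => simp [NodeFn.coord]
    | right i => simp [hcount]
  refine ⟨⟨A, hA, hA'⟩, fun N _ => ?_⟩
  obtain ⟨B, _, hB, hBA⟩ := HEGNN.exists_sumReLU.{v} A N
    (Fintype.piFinset fun _ : Fin p => ({0, 1} : Finset ℝ))
  refine ⟨B, hB, fun G hG x => ?_⟩
  have h := (hBA G hG (labelEmb G) (labelEmb_mem_piFinset G)).1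
  rw [h, hA']
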